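/- Let $\mathcal G$ be the space of Lipschitz functions $f:\mathbb R\to\mathbb R$ with Lipschitz constant $L_f$, with the norm $\|f\|_{\mathrm{Lip}}=|f(0)|+L_f$ and its Borel $\sigma$-algebra. Let $\nu$ be a probability measure on $\mathcal G$ and let $z_0\in\mathbb R$ be such that, for a random function $f$ with law $\nu$, $$\mathbf E L_f<\infty,\qquad \mathbf E\log L_f<0\quad(\text{where }\log 0=-\infty),\qquad \mathbf E|f(z_0)-z_0|<\infty .$$ For $g_1,g_2,\ldots\in\mathcal G$ write $g^{1\uparrow n}=g_1\circ\cdots\circ g_n$ and $g^{1\uparrow\infty}(z_0)=\lim_{n\to\infty}g^{1\uparrow n}(z_0)$ if the limit exists. Let $Z_\infty=f^{1\uparrow\infty}(z_0)$ be the almost sure limit of the backward iterations of i.i.d. functions $f_1,f_2,\ldots$ with law $\nu$. Let $\mathcal P$ be a Poisson process on $\mathbb R_+\times\mathbb R_+\times\mathcal G$ with intensity measure $\mathrm{Leb}\otimes\mathrm{Leb}\otimes\nu$. For $t,x>0$ let $\zeta_t(x)=f_1\circ\cdots\circ f_m(z_0)$, where $(t_1,x_1,f_1),\ldots,(t_m,x_m,f_m)$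 are the points of $\mathcal P$ in $[0,t]\times[0,x]\times\mathcal G$, numbered so that $t_1<\cdots<t_m$. Assume the recovery property: there is a Borel set $\mathcal S\subset\mathcal G$ with $\nu(\mathcal S)=1$ such that each $z\in\operatorname{supp}Z_\infty$ corresponds to a unique sequence $(g_n^z)_{n\ge1}$ of elements of $\mathcal S$ with $z=(g^z)^{1\uparrow\infty}(z_0)$, and, for every $n\ge 1$, the mapping $z\mapsto g_n^z$ is (the restriction to $\operatorname{supp}Z_\infty$ of) a measurable function from $\mathbb R$ to $\mathcal G$. Then, for every $x>0$, the almost sure limit $\zeta(x)=\lim_{t\to\infty}\zeta_t(x)$ exists, and the process $(\zeta(x))_{x>0}$ is Markov both in forward and in reverse time: with $\mathfrak F_I=\sigma(\zeta(u):u\in I)$, for every Borel set $B\subset\mathbb R$, $$\mathbf P\{\zeta(y)\in B\mid\mathfrak F_{(0,x]}\}=\mathbf P\{\zeta(y)\in B\mid\zeta(x)\}\quad\text{a.s. for all }0<x\le y,$$ $$\mathbf P\{\zeta(y)\in B\mid\mathfrak F_{[x,\infty)}\}=\mathbf P\{\zeta(y)\in B\mid\zeta(x)\}\quad\text{a.s.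 for all }0<y\le x .$$ -/

import Mathlib

open MeasureTheory ProbabilityTheory Filter Topology Set
open scoped ENNReal NNReal

noncomputable section

/-- The space `𝒢` of Lipschitz functions `ℝ → ℝ`. -/
structure LipFun where
  toFun : ℝ → ℝ
  lipschitz : ∃ K : ℝ≥0, LipschitzWith K toFun

namespace LipFun

instance : CoeFun LipFun (fun _ => ℝ → ℝ) := ⟨toFun⟩

theorem ext_fun {f g : LipFun} (h : ∀ x, f x = g x) : f = g := by
  cases f; cases g; congr; exact funext h

/-- The difference quotients of `f`. -/
def quotients (f : LipFun) : Set ℝ := {r | ∃ x y : ℝ, x ≠ y ∧ r = |f y - f x| / |x - y|}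

/-- The Lipschitz constant `L_f`, the supremum of the difference quotients of `f`. -/
def lipConst (f : LipFun) : ℝ := sSup f.quotients

theorem quotients_nonempty (f : LipFun) : f.quotients.Nonempty :=
  ⟨_, 0, 1, zero_ne_one, rfl⟩

theorem quotients_bddAbove (f : LipFun) : BddAbove f.quotients := by
  obtain ⟨K, hK⟩ := f.lipschitz
  refine ⟨K, ?_⟩
  rintro r ⟨x, y, hxy, rfl⟩
  have h := hK.dist_le_mul y x
  rw [Real.dist_eq, Real.dist_eq, abs_sub_comm y x] at h
  exact (div_le_iff₀ (abs_pos.2 (sub_ne_zero.2 hxy))).2 h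

theorem lipConst_nonneg (f : LipFun) : 0 ≤ f.lipConst := by
  apply Real.sSup_nonneg
  rintro r ⟨x, y, _, rfl⟩
  positivity

theorem abs_sub_le (f : LipFun) (x y : ℝ) : |f y - f x| ≤ f.lipConst * |x - y| := by
  by_cases hxy : x = y
  · simp [hxy]
  · exact (div_le_iff₀ (abs_pos.2 (sub_ne_zero.2 hxy))).1
      (le_csSup f.quotients_bddAbove ⟨x, y, hxy, rfl⟩)

theorem lipConst_le (f : LipFun) {c : ℝ} (h : ∀ x y, |f y - f x| ≤ c * |x - y|) :
    f.lipConst ≤ c := by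
  apply csSup_le f.quotients_nonempty
  rintro r ⟨x, y, hxy, rfl⟩
  exact (div_le_iff₀ (abs_pos.2 (sub_ne_zero.2 hxy))).2 (h x y)

instance : Sub LipFun where
  sub f g := ⟨fun x => f x - g x, by
    obtain ⟨K, hK⟩ := f.lipschitz
    obtain ⟨K', hK'⟩ := g.lipschitz
    exact ⟨K + K', hK.sub hK'⟩⟩

@[simp] theorem sub_apply (f g : LipFun) (x : ℝ) : (f - g) x = f x - g x := rfl

/-- The Lipschitz norm `‖f‖ = |f 0| + L_f`. -/
instance : Norm LipFun := ⟨fun f => |f 0| + f.lipConst⟩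

theorem norm_def (f : LipFun) : ‖f‖ = |f 0| + f.lipConst := rfl

/-- `𝒢` with the metric `‖f - g‖` of the Lipschitz norm. -/
instance : MetricSpace LipFun where
  dist f g := ‖f - g‖
  dist_self f := by
    have h : (f - f).lipConst ≤ 0 := lipConst_le _ (by simp)
    have h' := (f - f).lipConst_nonneg
    simp only [norm_def, sub_apply, sub_self, abs_zero, zero_add]
    linarith
  dist_comm f g := by
    have h : ∀ f g : LipFun, (f - g).lipConst ≤ (g - f).lipConst := fun f g =>
      lipConst_le _ fun x y => by
        have := (g - f).abs_sub_le x y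
        rw [← abs_neg] at this
        simp only [sub_apply] at this ⊢
        convert this using 2
        ring
    simp only [norm_def, sub_apply, abs_sub_comm (f 0) (g 0), le_antisymm (h f g) (h g f)]
  dist_triangle f g k := by
    have h : (f - k).lipConst ≤ (f - g).lipConst + (g - k).lipConst :=
      lipConst_le _ fun x y => by
        have h1 := (f - g).abs_sub_le x y
        have h2 := (g - k).abs_sub_le x y
        simp only [sub_apply] at h1 h2 ⊢
        have h3 := abs_add_le (f y - g y - (f x - g x)) (g y - k y - (g x - k x))
        have h4 : f y - g y - (f x - g x) + (g y - k y - (g x - k x))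
            = f y - k y - (f x - k x) := by ring
        rw [h4] at h3
        linarith
    have h0 := _root_.abs_sub_le (f 0) (g 0) (k 0)
    change |f 0 - k 0| + (f - k).lipConst
      ≤ |f 0 - g 0| + (f - g).lipConst + (|g 0 - k 0| + (g - k).lipConst)
    linarith
  eq_of_dist_eq_zero := by
    intro f g h
    change |(f - g) 0| + (f - g).lipConst = 0 at h
    have h1 := (f - g).lipConst_nonneg
    have h2 := abs_nonneg ((f - g) 0)
    have h3 : (f - g).lipConst = 0 := by linarith
    have h4 : (f - g) 0 = 0 := abs_eq_zero.1 (by linarith)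
    refine ext_fun fun x => ?_
    have h5 := (f - g).abs_sub_le 0 x
    rw [h3, zero_mul, h4, sub_zero] at h5
    have h6 : (f - g) x = 0 := abs_eq_zero.1 (le_antisymm h5 (abs_nonneg _))
    exact sub_eq_zero.1 h6

/-- The Borel σ-algebra of the Lipschitz norm. -/
instance : MeasurableSpace LipFun := borel LipFun

instance : BorelSpace LipFun := ⟨rfl⟩

end LipFun

/-- The mean of an extended real random variable, `E X⁺ - E X⁻`. -/
def extMean {Ω : Type*} [MeasurableSpace Ω] (P : Measure Ω) (X : Ω → EReal) : EReal :=
  ((∫⁻ ω, (X ω).toENNReal ∂P : ℝ≥0∞) : EReal) - ((∫⁻ ω, (-X ω).toENNReal ∂P : ℝ≥0∞) : EReal)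

/-- The standing conditions on the law `ν` of the random function `f` and on the starting point:
`E L_f < ∞`, `E log L_f < 0` (with `log 0 = -∞`) and `E |f z₀ - z₀| < ∞`. -/
structure ContractiveInMean (ν : Measure LipFun) (z₀ : ℝ) : Prop where
  integrable_lipConst : Integrable (fun f : LipFun => f.lipConst) ν
  mean_log_neg : extMean ν (fun f => ENNReal.log (ENNReal.ofReal f.lipConst)) < 0
  integrable_displacement : Integrable (fun f : LipFun => |f z₀ - z₀|) ν

/-- The backward iteration `g 0 ∘ g 1 ∘ ⋯ ∘ g (n - 1)` applied to `z`. -/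
def backIter (g : ℕ → LipFun) : ℕ → ℝ → ℝ
  | 0, z => z
  | n + 1, z => backIter g n (g n z)

/-- The law of `Z_∞`, the almost sure limit of the backward iterations `f_1 ∘ ⋯ ∘ f_n (z₀)` of
i.i.d. random functions with law `ν`. -/
def limitLaw (ν : Measure LipFun) [IsProbabilityMeasure ν] (z₀ : ℝ) : Measure ℝ :=
  (Measure.infinitePi (fun _ : ℕ => ν)).map
    (fun f => limUnder atTop (fun n => backIter f n z₀))

/-- The Poisson law with mean `r ∈ [0, ∞]`, on `ℕ ∪ {∞}`. -/
def extPoisson (r : ℝ≥0∞) : Measure ℕ∞ :=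
  if r = ∞ then Measure.dirac ⊤ else (poissonMeasure r.toNNReal).map (fun n : ℕ => (n : ℕ∞))

/-- The random set `N` of points of `E` is a Poisson process with intensity measure `Λ`. -/
structure IsPoissonProcess {Ω E : Type*} [MeasurableSpace Ω] [MeasurableSpace E]
    (N : Ω → Set E) (Λ : Measure E) (P : Measure Ω) : Prop where
  measurable_count : ∀ B : Set E, MeasurableSet B → Measurable fun ω => (N ω ∩ B).encard
  count_law : ∀ B : Set E, MeasurableSet B →
    P.map (fun ω => (N ω ∩ B).encard) = extPoisson (Λ B)
  indep_count : ∀ (n : ℕ) (B : Fin n → Set E), (∀ i, MeasurableSet (B i)) →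
    Pairwise (fun i j => Disjoint (B i) (B j)) →
    iIndepFun (fun i ω => (N ω ∩ B i).encard) P

/-- The intensity `Leb ⊗ Leb ⊗ ν` on `ℝ₊ × ℝ₊ × 𝒢`. -/
def sieveIntensity (ν : Measure LipFun) : Measure (ℝ × ℝ × LipFun) :=
  (volume.restrict (Ici (0 : ℝ))).prod ((volume.restrict (Ici (0 : ℝ))).prod ν)

open Classical in
/-- The list of the points `(t, x, f)` of a finite set with distinct first coordinates, in the
order of increasing first coordinates (and the empty list for all other sets). -/
def timeOrdered (s : Set (ℝ × ℝ × LipFun)) : List (ℝ × ℝ × LipFun) :=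
  if h : ∃ l : List (ℝ × ℝ × LipFun),
      l.Pairwise (fun p q => p.1 < q.1) ∧ ∀ p, p ∈ l ↔ p ∈ s
  then h.choose else []

/-- The sieved backward iteration `ζ_t([0, x])` along a set `s` of points `(t_i, x_i, f_i)`: the
composition `f_1 ∘ ⋯ ∘ f_N (z₀)` of the marks of the points of `s` in `[0, t] × [0, x] × 𝒢`,
numbered in the order of increasing `t_i`. -/
def sievedIter (s : Set (ℝ × ℝ × LipFun)) (z₀ t x : ℝ) : ℝ :=
  (timeOrdered (s ∩ {p | p.1 ∈ Icc 0 t ∧ p.2.1 ∈ Icc 0 x})).foldr (fun p z => p.2.2 z) z₀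

/-- `ζ` is (a version of) the process of the almost sure limits
`ζ(x) = lim_{t → ∞} ζ_t([0, x])`, `x > 0`. -/
structure IsSievedLimit {Ω : Type*} [MeasurableSpace Ω] (P : Measure Ω)
    (N : Ω → Set (ℝ × ℝ × LipFun)) (z₀ : ℝ) (ζ : ℝ → Ω → ℝ) : Prop where
  measurable : ∀ x, 0 < x → Measurable (ζ x)
  tendsto : ∀ x, 0 < x →
    ∀ᵐ ω ∂P, Tendsto (fun t => sievedIter (N ω) z₀ t x) atTop (𝓝 (ζ x ω))

/-- The σ-algebra generated by `ζ(x)`, `x ∈ I`. -/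
abbrev genSigma {Ω : Type*} (ζ : ℝ → Ω → ℝ) (I : Set ℝ) : MeasurableSpace Ω :=
  ⨆ x ∈ I, MeasurableSpace.comap (ζ x) inferInstance

/-- `(ζ(x))_{x > 0}` is Markov in forward time, with respect to the σ-algebras generated by
`ζ(u)`, `u ∈ (0, x]`. -/
def IsMarkovForward {Ω : Type*} [MeasurableSpace Ω] (P : Measure Ω) (ζ : ℝ → Ω → ℝ) : Prop :=
  ∀ x y : ℝ, 0 < x → x ≤ y → ∀ B : Set ℝ, MeasurableSet B →
    P⟦ζ y ⁻¹' B | genSigma ζ (Ioc 0 x)⟧ =ᵐ[P] P⟦ζ y ⁻¹' B | genSigma ζ {x}⟧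

/-- `(ζ(x))_{x > 0}` is Markov in reverse time, with respect to the σ-algebras generated by
`ζ(u)`, `u ∈ [x, ∞)`. -/
def IsMarkovReverse {Ω : Type*} [MeasurableSpace Ω] (P : Measure Ω) (ζ : ℝ → Ω → ℝ) : Prop :=
  ∀ x y : ℝ, 0 < y → y ≤ x → ∀ B : Set ℝ, MeasurableSet B →
    P⟦ζ y ⁻¹' B | genSigma ζ (Ici x)⟧ =ᵐ[P] P⟦ζ y ⁻¹' B | genSigma ζ {x}⟧

/-- The recovery property, for a set `S` of realisations of the random function: `g n z` depends
measurably on `z`, and for each `z` in the support of `Z_∞` the sequence `(g n z)_n` is the unique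
sequence from `S` whose backward iterations at `z₀` converge to `z`. -/
structure HasRecovery (ν : Measure LipFun) [IsProbabilityMeasure ν] (z₀ : ℝ) (S : Set LipFun)
    (g : ℕ → ℝ → LipFun) : Prop where
  measurable : ∀ n, Measurable (g n)
  mem : ∀ z ∈ (limitLaw ν z₀).support, ∀ n, g n z ∈ S
  tendsto : ∀ z ∈ (limitLaw ν z₀).support,
    Tendsto (fun n => backIter (fun k => g k z) n z₀) atTop (𝓝 z)
  unique : ∀ z ∈ (limitLaw ν z₀).support, ∀ h : ℕ → LipFun, (∀ n, h n ∈ S) →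
    Tendsto (fun n => backIter h n z₀) atTop (𝓝 z) → ∀ n, h n = g n z

end

/-! Fix `x > 0` and list the points of the strip `[0, ∞) × [0, x] × 𝒢` in the order of time. Their
marks `(X_k, f_k)` are i.i.d., with `X_k` uniform on `[0, x]` and independent of `f_k ~ ν`, and the
whole mark sequence is independent of the times and of the points outside the strip. Hence three
σ-algebras are independent: that of the functions, that of the positions, and the outer one,
generated by the times and the outside points.

The value `ζ(x)` is the limit of the backward iterations of the `f_k`, and the recovery property
reads every `f_k` off `ζ(x)`. So up to null sets `σ(ζ(x))` is the σ-algebra of the functions. For `u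
≤ x`, `ζ(u)` arises by replacing `f_k` with the identity when `X_k > u`, so it depends on functions
and positions only. For `u ≥ x`, the sequence of functions in the larger strip is obtained by
merging the `f_k` with the outside points according to time, so `ζ(u)` depends on functions and
outer data only. Left and right are therefore conditionally independent given `ζ(x)`, which is the
Markov property in both directions (`exists_sides`, `condExp_eq_of_indep_sup`).

The Poisson process is given only through counts of points, so the mark structure has to be derived
from these. The decisive step is `prob_mark_step`: on a fine dyadic grid the `k`-th point is alone
in its cell, where its mark has the normalised intensity as its law and is independent of everything
outside the cell. Existence of the limits rests on `ContractiveInMean.exists_moment_lt_one`: a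
moment `E L_f ^ p < 1` makes the increments of the backward iterations summable. -/

noncomputable section

/-! ### Enumerating a configuration of points by time -/

/-- An infinite set of points `(t, y)` with pairwise distinct times `t`, finitely many of which
lie before any given time. -/
structure IsTimeConfig {K : Type*} (s : Set (ℝ × K)) : Prop where
  finite_before : ∀ t, (s ∩ {p | p.1 < t}).Finite
  injOn : InjOn Prod.fst s
  infinite : s.Infinite

/-- The sequence `p` enumerates `s` in the order of increasing times. -/
structure Enumerates {K : Type*} (p : ℕ → ℝ × K) (s : Set (ℝ × K)) : Prop where
  strictMono : StrictMono fun k => (p k).1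
  tendsto : Tendsto (fun k => (p k).1) atTop atTop
  range_eq : range p = s

/-- The rank of a point, the number of earlier points, is finite and injective. Its values fill all
of `ℕ`, and inverting it gives the enumeration. -/
theorem IsTimeConfig.exists_enumerates {K : Type*} {s : Set (ℝ × K)} (hs : IsTimeConfig s) :
    ∃ p, Enumerates p s := by
  set c : ℝ × K → ℕ := fun p => (s ∩ {q | q.1 < p.1}).ncard with hc
  have hlt : ∀ p ∈ s, ∀ q ∈ s, p.1 < q.1 → c p < c q := by
    intro p hp q hq hpq
    refine ncard_lt_ncard ⟨fun r hr => ⟨hr.1, lt_trans hr.2 hpq⟩, fun h => ?_⟩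
      (hs.finite_before _)
    exact lt_irrefl p.1 (h (⟨hp, hpq⟩ : p ∈ s ∩ {r | r.1 < q.1})).2
  have hinj : InjOn c s := by
    intro p hp q hq hpq
    rcases lt_trichotomy p.1 q.1 with h | h | h
    · exact absurd hpq (hlt p hp q hq h).ne
    · exact hs.injOn hp hq h
    · exact absurd hpq (hlt q hq p hp h).ne'
  have hsurj : ∀ k, ∃ p ∈ s, c p = k := by
    intro k
    obtain ⟨_, ⟨p, hp, rfl⟩, hk⟩ := (hs.infinite.image hinj).exists_gt k
    have hfin := hs.finite_before p.1
    -- The ranks of the `c p` points before `p` are distinct and below `c p`, so every such number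
    -- occurs.
    have himg : c '' (s ∩ {q | q.1 < p.1}) = Iio (c p) := by
      apply Set.eq_of_subset_of_ncard_le
      · rintro _ ⟨q, hq, rfl⟩
        exact hlt q hq.1 p hp hq.2
      · rw [(hinj.mono inter_subset_left).ncard_image, ← Nat.card_coe_set_eq (Iio (c p))]
        simp [hc]
      · exact finite_Iio _
    obtain ⟨q, hq, hqk⟩ : k ∈ c '' (s ∩ {q | q.1 < p.1}) := himg ▸ hk
    exact ⟨q, hq.1, hqk⟩
  choose p hp hpc using hsurj
  have hmono : StrictMono fun k => (p k).1 := by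
    intro i j hij
    by_contra! h
    rcases h.lt_or_eq with h | h
    · have := hlt _ (hp j) _ (hp i) h
      rw [hpc, hpc] at this
      omega
    · have := hs.injOn (hp j) (hp i) h
      have h2 := hpc j
      rw [this, hpc] at h2
      omega
  have hrange : range p = s := by
    ext q
    constructor
    · rintro ⟨k, rfl⟩
      exact hp k
    · intro hq
      exact ⟨c q, hinj (hp _) hq (hpc _)⟩
  refine ⟨p, hmono, tendsto_atTop_atTop_of_monotone hmono.monotone fun t => ?_, hrange⟩
  by_contra! h
  refine hs.infinite ((hs.finite_before t).subset fun q hq => ⟨hq, ?_⟩)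
  obtain ⟨k, rfl⟩ := hrange.symm ▸ hq
  exact h k

namespace Enumerates

variable {K : Type*} {p : ℕ → ℝ × K} {s : Set (ℝ × K)}

theorem injective (h : Enumerates p s) : Function.Injective p :=
  fun _ _ hij => h.strictMono.injective (congrArg Prod.fst hij)

theorem mem (h : Enumerates p s) (k : ℕ) : p k ∈ s := h.range_eq ▸ mem_range_self k

theorem exists_index (h : Enumerates p s) (a : ℝ) : ∃ m : ℕ, ∀ i, (p i).1 < a ↔ i < m := by
  classical
  have hex : ∃ m, a ≤ (p m).1 := (h.tendsto.eventually_ge_atTop a).exists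
  refine ⟨Nat.find hex, fun i => ⟨fun hi => ?_, fun hi => ?_⟩⟩
  · by_contra! hle
    exact absurd ((Nat.find_spec hex).trans (h.strictMono.monotone hle)) (not_le.2 hi)
  · exact not_le.1 (Nat.find_min hex hi)

theorem encard_inter_prod (h : Enumerates p s) (I : Set ℝ) (E : Set K) :
    (s ∩ I ×ˢ E).encard = {i | (p i).1 ∈ I ∧ (p i).2 ∈ E}.encard := by
  rw [← h.injective.encard_image]
  congr 1
  ext q
  simp only [mem_inter_iff, mem_prod, mem_image, mem_ofPred_eq, ← h.range_eq, mem_range]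
  constructor
  · rintro ⟨⟨i, rfl⟩, hi⟩
    exact ⟨i, hi, rfl⟩
  · rintro ⟨i, hi, rfl⟩
    exact ⟨⟨i, rfl⟩, hi⟩

theorem encard_before (h : Enumerates p s) {a : ℝ} {m : ℕ} (hm : ∀ i, (p i).1 < a ↔ i < m) :
    (s ∩ Iio a ×ˢ univ).encard = m := by
  rw [h.encard_inter_prod]
  simp only [mem_Iio, hm, mem_univ, and_true]
  exact (Finset.coe_range m ▸ encard_coe_eq_coe_finsetCard (Finset.range m)).trans (by simp)

theorem encard_before_eq_iff (h : Enumerates p s) {a : ℝ} {k : ℕ} :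
    (s ∩ Iio a ×ˢ univ).encard = k ↔ ∀ i, (p i).1 < a ↔ i < k := by
  refine ⟨fun hk => ?_, h.encard_before⟩
  obtain ⟨m, hm⟩ := h.exists_index a
  rw [h.encard_before hm] at hk
  rwa [← Nat.cast_inj.1 hk]

theorem encard_Ico (h : Enumerates p s) {a b : ℝ} {m n : ℕ} (hm : ∀ i, (p i).1 < a ↔ i < m)
    (hn : ∀ i, (p i).1 < b ↔ i < n) (E : Set K) :
    (s ∩ Ico a b ×ˢ E).encard = {i | m ≤ i ∧ i < n ∧ (p i).2 ∈ E}.encard := by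
  rw [h.encard_inter_prod]
  simp only [mem_Ico, ← not_lt, hm, hn, and_assoc]

/-- With `k` points before `a`, a single point in `[a, b)` must be the `k`-th one, so counting in
`[a, b) ×ˢ E` tests its mark. -/
theorem isolated_iff (h : Enumerates p s) {a b : ℝ} {k : ℕ} (E : Set K)
    (ha : (s ∩ Iio a ×ˢ univ).encard = k) (hab : (s ∩ Ico a b ×ˢ univ).encard = 1) :
    (a ≤ (p k).1 ∧ (p k).1 < b) ∧ ((s ∩ Ico a b ×ˢ E).encard = 1 ↔ (p k).2 ∈ E) := by
  rw [h.encard_before_eq_iff] at ha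
  obtain ⟨n, hn⟩ := h.exists_index b
  rw [h.encard_Ico ha hn] at hab ⊢
  have hset : {i | k ≤ i ∧ i < n ∧ (p i).2 ∈ univ} = ↑(Finset.Ico k n) := by
    ext i; simp
  rw [hset, encard_coe_eq_coe_finsetCard] at hab
  have hnk : n = k + 1 := by
    have : n - k = 1 := by rw [Nat.card_Ico] at hab; exact_mod_cast hab
    omega
  subst hnk
  have hset2 : {i | k ≤ i ∧ i < k + 1 ∧ (p i).2 ∈ E} = {i | i = k ∧ (p k).2 ∈ E} := by
    ext i
    constructor
    · rintro ⟨h1, h2, h3⟩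
      obtain rfl : i = k := by omega
      exact ⟨rfl, h3⟩
    · rintro ⟨rfl, h3⟩
      exact ⟨le_rfl, by omega, h3⟩
  refine ⟨⟨not_lt.1 fun hlt => lt_irrefl _ ((ha k).1 hlt), (hn k).2 (by omega)⟩, ?_⟩
  rw [hset2]
  by_cases hE : (p k).2 ∈ E <;> simp [hE]

theorem exists_isolating (h : Enumerates p s) {Q : Set ℝ} (hQ : Dense Q) {k : ℕ} {c : ℝ}
    (hc : (p k).1 < c) :
    ∃ a ∈ Q, ∃ b ∈ Q, a < (p k).1 ∧ (p k).1 < b ∧ b ≤ c ∧ (s ∩ Iio a ×ˢ univ).encard = k ∧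
      (s ∩ Ico a b ×ˢ univ).encard = 1 := by
  -- The point with index `0` has no predecessor, so any earlier time serves as lower bound.
  have hlow : ∃ l < (p k).1, ∀ i < k, (p i).1 ≤ l := by
    rcases k with _ | k
    · exact ⟨(p 0).1 - 1, by linarith, by simp⟩
    · exact ⟨(p k).1, h.strictMono (Nat.lt_succ_self k),
        fun i hi => h.strictMono.monotone (Nat.lt_succ_iff.1 hi)⟩
  obtain ⟨l, hl, hli⟩ := hlow
  obtain ⟨a, haQ, hla, hak⟩ := hQ.exists_between hl
  obtain ⟨b, hbQ, hkb, hbm⟩ := hQ.exists_between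
    (lt_min (h.strictMono (Nat.lt_succ_self k)) hc)
  have hb' := lt_min_iff.1 hbm
  have ha : ∀ i, (p i).1 < a ↔ i < k := fun i =>
    ⟨fun hi => h.strictMono.lt_iff_lt.1 (hi.trans hak), fun hi => (hli i hi).trans_lt hla⟩
  have hb : ∀ i, (p i).1 < b ↔ i < k + 1 := fun i =>
    ⟨fun hi => h.strictMono.lt_iff_lt.1 (hi.trans hb'.1),
      fun hi => (h.strictMono.monotone (Nat.lt_succ_iff.1 hi)).trans_lt hkb⟩
  refine ⟨a, haQ, b, hbQ, hak, hkb, hb'.2.le, h.encard_before ha, ?_⟩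
  rw [h.encard_Ico ha hb]
  have hset : {i | k ≤ i ∧ i < k + 1 ∧ (p i).2 ∈ univ} = {k} := by
    ext i
    simp only [mem_univ, and_true, mem_ofPred_eq, mem_singleton_iff]
    omega
  rw [hset, encard_singleton]

/-- For countable `Q` the right side is a countable union of events about counts; this is what makes
the marks measurable. -/
theorem mark_mem_iff (h : Enumerates p s) {Q : Set ℝ} (hQ : Dense Q) {k : ℕ} (E : Set K) :
    (p k).2 ∈ E ↔ ∃ a ∈ Q, ∃ b ∈ Q, (s ∩ Iio a ×ˢ univ).encard = k ∧
      (s ∩ Ico a b ×ˢ univ).encard = 1 ∧ (s ∩ Ico a b ×ˢ E).encard = 1 := by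
  constructor
  · intro hE
    obtain ⟨a, ha, b, hb, -, -, -, h1, h2⟩ := h.exists_isolating hQ (lt_add_one (p k).1)
    exact ⟨a, ha, b, hb, h1, h2, (h.isolated_iff E h1 h2).2.2 hE⟩
  · rintro ⟨a, -, b, -, h1, h2, h3⟩
    exact (h.isolated_iff E h1 h2).2.1 h3

/-- The localised version: only counts before `c` enter, so marks of points before a cell are
determined by points outside that cell. -/
theorem mark_mem_iff_of_lt (h : Enumerates p s) {Q : Set ℝ} (hQ : Dense Q) {k : ℕ} (E : Set K)
    {c : ℝ} (hc : (p k).1 < c) :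
    (p k).2 ∈ E ↔ ∃ a ∈ Q, ∃ b ∈ Q, a ≤ c ∧ b ≤ c ∧ (s ∩ Iio a ×ˢ univ).encard = k ∧
      (s ∩ Ico a b ×ˢ univ).encard = 1 ∧ (s ∩ Ico a b ×ˢ E).encard = 1 := by
  constructor
  · intro hE
    obtain ⟨a, ha, b, hb, hak, -, hbc, h1, h2⟩ := h.exists_isolating hQ hc
    exact ⟨a, ha, b, hb, (hak.trans hc).le, hbc, h1, h2, (h.isolated_iff E h1 h2).2.2 hE⟩
  · rintro ⟨a, -, b, -, -, -, h1, h2, h3⟩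
    exact (h.isolated_iff E h1 h2).2.1 h3

end Enumerates

/-! ### Sieved iterations as backward iterations -/

/-- The identity function as an element of `𝒢`. -/
def LipFun.ident : LipFun := ⟨id, 1, LipschitzWith.id⟩

theorem backIter_eq_foldr (g : ℕ → LipFun) (n : ℕ) (z : ℝ) :
    backIter g n z = (List.range n).foldr (fun i w => g i w) z := by
  induction n generalizing z with
  | zero => rfl
  | succ n ih => rw [backIter, ih, List.range_succ, List.foldr_append]; rfl

/-- A list with strictly increasing times has no repetitions, and two such lists with the same
members are sorted permutations of each other, hence equal. The choice in `timeOrdered` is thus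
immaterial. -/
theorem timeOrdered_eq {l : List (ℝ × ℝ × LipFun)} {s : Set (ℝ × ℝ × LipFun)}
    (hl : l.Pairwise (fun p q => p.1 < q.1)) (hs : ∀ p, p ∈ l ↔ p ∈ s) : timeOrdered s = l := by
  have hex : ∃ l : List (ℝ × ℝ × LipFun),
      l.Pairwise (fun p q => p.1 < q.1) ∧ ∀ p, p ∈ l ↔ p ∈ s := ⟨l, hl, hs⟩
  rw [timeOrdered, dif_pos hex]
  obtain ⟨h1, h2⟩ := hex.choose_spec
  have hnd : ∀ {l : List (ℝ × ℝ × LipFun)}, l.Pairwise (fun p q => p.1 < q.1) → l.Nodup :=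
    fun h => h.imp fun {a b} hlt heq => absurd hlt (by rw [heq]; exact lt_irrefl _)
  have hperm := (List.perm_ext_iff_of_nodup (hnd h1) (hnd hl)).2 fun p => (h2 p).trans (hs p).symm
  exact hperm.eq_of_pairwise (fun a b _ _ hab hba => absurd (hab.trans hba) (lt_irrefl _)) h1 hl

open Classical in
/-- The sieved sequence of marks: marks `(x, f)` with `x ∉ [0, u]` act as the identity. -/
def sieve (u : ℝ) (y : ℕ → ℝ × LipFun) (i : ℕ) : LipFun :=
  if (y i).1 ∈ Icc 0 u then (y i).2 else LipFun.ident

/-- The region `[0, x] × 𝒢` of marks. -/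
def markRegion (x : ℝ) : Set (ℝ × LipFun) := Icc 0 x ×ˢ univ

/-- Points with positions in `(u, x]` act as the identity after sieving, so one enumeration of the
strip of `x` serves all levels `u ≤ x`. -/
theorem sievedIter_eq_backIter {N : Set (ℝ × ℝ × LipFun)} {p : ℕ → ℝ × ℝ × LipFun} {x u t : ℝ}
    (hux : u ≤ x) (h : Enumerates p (N ∩ Ici 0 ×ˢ markRegion x)) {m : ℕ} (hm : ∀ i,
        (p i).1 ≤ t ↔ i < m)
    (z₀ : ℝ) : sievedIter N z₀ t u = backIter (sieve u fun i => (p i).2) m z₀ := by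
  classical
  set l := ((List.range m).map p).filter (fun q => q.2.1 ∈ Icc 0 u) with hl
  have hord : timeOrdered (N ∩ {p | p.1 ∈ Icc 0 t ∧ p.2.1 ∈ Icc 0 u}) = l := by
    apply timeOrdered_eq
    · refine List.Pairwise.filter _ (List.pairwise_map.2 ?_)
      exact List.pairwise_lt_range.imp fun hij => h.strictMono hij
    · intro q
      simp only [hl, List.mem_filter, List.mem_map, List.mem_range, decide_eq_true_eq]
      constructor
      · rintro ⟨⟨i, hi, rfl⟩, hu⟩
        have := h.mem i
        exact ⟨this.1, ⟨this.2.1, (hm i).2 hi⟩, hu⟩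
      · rintro ⟨hN, h0, hu⟩
        have : q ∈ N ∩ Ici 0 ×ˢ markRegion x := ⟨hN, h0.1, ⟨hu.1, hu.2.trans hux⟩, trivial⟩
        rw [← h.range_eq] at this
        obtain ⟨i, rfl⟩ := this
        exact ⟨⟨i, (hm i).1 h0.2, rfl⟩, hu⟩
  rw [sievedIter, hord, backIter_eq_foldr, hl, List.foldr_filter, List.foldr_map]
  congr 1
  ext i z
  by_cases hi : (p i).2.1 ∈ Icc 0 u
  · simp [sieve, hi]
  · simp [sieve, hi, LipFun.ident]

theorem sieve_eq_of_mem {u : ℝ} {y : ℕ → ℝ × LipFun} (h : ∀ i, (y i).1 ∈ Icc 0 u) :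
    sieve u y = fun i => (y i).2 :=
  funext fun i => if_pos (h i)

/-- Along the times of the points, the sieved iterations are backward iterations. -/
theorem sievedIter_time {N : Set (ℝ × ℝ × LipFun)} {p : ℕ → ℝ × ℝ × LipFun} {x u : ℝ}
    (hux : u ≤ x) (h : Enumerates p (N ∩ Ici 0 ×ˢ markRegion x)) (k : ℕ) (z₀ : ℝ) :
    sievedIter N z₀ (p k).1 u = backIter (sieve u fun i => (p i).2) (k + 1) z₀ :=
  sievedIter_eq_backIter hux h (fun i => by
    rw [Nat.lt_succ_iff]; exact h.strictMono.le_iff_le) z₀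

/-- As a function of `t` the sieved iteration is a step function running through the backward
iterations, and the number of steps tends to infinity. -/
theorem tendsto_sievedIter {N : Set (ℝ × ℝ × LipFun)} {p : ℕ → ℝ × ℝ × LipFun} {x z₀ z : ℝ}
    (h : Enumerates p (N ∩ Ici 0 ×ˢ markRegion x))
    (hz : Tendsto (fun n => backIter (fun i => (p i).2.2) n z₀) atTop (𝓝 z)) :
    Tendsto (fun t => sievedIter N z₀ t x) atTop (𝓝 z) := by
  have hex : ∀ t, ∃ m : ℕ, ∀ i, (p i).1 ≤ t ↔ i < m := by
    classical
    intro t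
    have hex : ∃ m, t < (p m).1 := (h.tendsto.eventually_gt_atTop t).exists
    refine ⟨Nat.find hex, fun i => ⟨fun hi => ?_, fun hi => not_lt.1 (Nat.find_min hex hi)⟩⟩
    by_contra! hle
    exact absurd ((Nat.find_spec hex).trans_le (h.strictMono.monotone hle)) (not_lt.2 hi)
  choose m hm using hex
  have hs : sieve x (fun i => (p i).2) = fun i => (p i).2.2 :=
    sieve_eq_of_mem fun i => (h.mem i).2.2.1
  have htop : Tendsto m atTop atTop := by
    refine tendsto_atTop.2 fun k => ?_
    filter_upwards [eventually_ge_atTop (p k).1] with t ht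
    exact ((hm t k).1 ht).le
  refine (hz.comp htop).congr fun t => ?_
  rw [sievedIter_eq_backIter le_rfl h (hm t), hs]
  rfl

/-! ### Independence of the points in complementary regions -/

/-- The σ-algebra generated by the numbers of points of `N` in the measurable subsets of `B`. -/
@[reducible] def countSigma {Ω E : Type*} [MeasurableSpace E] (N : Ω → Set E) (B : Set E) :
    MeasurableSpace Ω :=
  ⨆ O : {O : Set E // MeasurableSet O ∧ O ⊆ B},
    MeasurableSpace.comap (fun ω => (N ω ∩ O).encard) inferInstance

/-- The atom of the partition generated by the sets `O i`, `i ∈ ι`, and `B`. -/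
def partitionAtom {E ι : Type*} (O : ι → Set E) (B : Set E) (j : (ι → Prop) × Prop) : Set E :=
  {e | (fun i => e ∈ O i) = j.1 ∧ (e ∈ B) = j.2}

/-- The set `O i ∩ B` is a finite disjoint union of atoms, so its count is a finite sum of counts.
-/
theorem measurable_count_of_atoms {Ω E ι : Type*} {N : Ω → Set E} [Finite ι] {O : ι → Set E}
    {B : Set E}
    {m : MeasurableSpace Ω}
    (h : ∀ ε : ι → Prop, Measurable[m] fun ω => (N ω ∩ partitionAtom O B (ε, True)).encard)
    (i : ι) : Measurable[m] fun ω => (N ω ∩ (O i ∩ B)).encard := by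
  classical
  have := Fintype.ofFinite ι
  have hset : ∀ ω, N ω ∩ (O i ∩ B)
      = ⋃ ε : {ε : ι → Prop // ε i}, N ω ∩ partitionAtom O B (ε, True) := by
    intro ω
    ext e
    simp only [mem_inter_iff, mem_iUnion, partitionAtom, mem_ofPred_eq, Subtype.exists,
      exists_prop]
    constructor
    · rintro ⟨h1, h2, h3⟩
      exact ⟨fun i => e ∈ O i, h2, h1, rfl, eq_true h3⟩
    · rintro ⟨ε, h1, h2, rfl, h3⟩
      exact ⟨h2, h1, of_eq_true h3⟩
  have hfun : (fun ω => (N ω ∩ (O i ∩ B)).encard) = fun ω =>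
      ∑ ε : {ε : ι → Prop // ε i}, (N ω ∩ partitionAtom O B (ε, True)).encard := by
    funext ω
    rw [hset, encard_iUnion_of_finite, finsum_eq_sum_of_fintype]
    intro ε ε' hne
    refine Set.disjoint_left.2 fun e he he' => hne (Subtype.ext ?_)
    exact he.2.1.symm.trans he'.2.1
  rw [hfun]
  exact Finset.measurable_sum _ fun ε _ => h ε

section CountSigma

variable {Ω E : Type*} [MeasurableSpace E] {N : Ω → Set E}

theorem measurable_count_of_subset {B O : Set E} (hO : MeasurableSet O) (hOB : O ⊆ B) :
    Measurable[countSigma N B] fun ω => (N ω ∩ O).encard :=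
  measurable_iff_comap_le.2 (le_iSup
    (fun O : {O : Set E // MeasurableSet O ∧ O ⊆ B} =>
      MeasurableSpace.comap (fun ω => (N ω ∩ O).encard) inferInstance) ⟨O, hO, hOB⟩)

theorem countSigma_le_of_measurable {B : Set E} {m : MeasurableSpace Ω}
    (h : ∀ O, MeasurableSet O → O ⊆ B → Measurable[m] fun ω => (N ω ∩ O).encard) :
    countSigma N B ≤ m :=
  iSup_le fun O => measurable_iff_comap_le.1 (h O O.2.1 O.2.2)

theorem countSigma_mono {B B' : Set E} (h : B ⊆ B') : countSigma N B ≤ countSigma N B' :=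
  countSigma_le_of_measurable fun _ hO hOB => measurable_count_of_subset hO (hOB.trans h)

variable [MeasurableSpace Ω] {P : Measure Ω} {Λ : Measure E}

theorem IsPoissonProcess.countSigma_le (hN : IsPoissonProcess N Λ P) (B : Set E) :
    countSigma N B ≤ ‹MeasurableSpace Ω› :=
  countSigma_le_of_measurable fun O hO _ => hN.measurable_count O hO

theorem measurableSet_partitionAtom {ι : Type*} [Finite ι] {O : ι → Set E} {B : Set E}
    (hO : ∀ i, MeasurableSet (O i)) (hB : MeasurableSet B) (j : (ι → Prop) × Prop) :
    MeasurableSet (partitionAtom O B j) := by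
  have h : partitionAtom O B j
      = (⋂ i, {e | (e ∈ O i) = j.1 i}) ∩ {e | (e ∈ B) = j.2} := by
    ext e
    simp [partitionAtom, funext_iff]
  have aux : ∀ (A : Set E) (q : Prop), MeasurableSet A → MeasurableSet {e | (e ∈ A) = q} := by
    intro A q hA
    by_cases hq : q
    · simpa [hq] using hA
    · simp only [hq, eq_iff_iff, iff_false]
      exact hA.compl
  rw [h]
  exact (MeasurableSet.iInter fun i => aux _ _ (hO i)).inter (aux _ _ hB)

theorem IsPoissonProcess.iIndepFun_atoms (hN : IsPoissonProcess N Λ P) {ι : Type*} [Finite ι]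
    {O : ι → Set E} {B : Set E} (hO : ∀ i, MeasurableSet (O i)) (hB : MeasurableSet B) :
    iIndepFun (fun j ω => (N ω ∩ partitionAtom O B j).encard) P := by
  classical
  have : Fintype ι := Fintype.ofFinite ι
  let e := Fintype.equivFin ((ι → Prop) × Prop)
  have h := hN.indep_count _ (fun i => partitionAtom O B (e.symm i))
    (fun i => measurableSet_partitionAtom hO hB _) (fun i j hij => by
      refine Set.disjoint_left.2 fun x hx hx' => hij (e.symm.injective ?_)
      exact Prod.ext (hx.1.symm.trans hx'.1) (hx.2.symm.trans hx'.2))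
  simpa using h.precomp e.injective

/-- Independence is given only for disjoint sets, whereas the generators overlap. Finitely many of
them split into atoms inside and outside `B`, whose counts are jointly independent; the directed
union over finite families gives the full σ-algebras. -/
theorem IsPoissonProcess.indep_countSigma_compl [IsProbabilityMeasure P]
    (hN : IsPoissonProcess N Λ P) {B : Set E} (hB : MeasurableSet B) :
    Indep (countSigma N B) (countSigma N Bᶜ) P := by
  classical
  let fam : Set E → Finset {O : Set E // MeasurableSet O} → MeasurableSpace Ω := fun B F =>
    ⨆ O ∈ F, MeasurableSpace.comap (fun ω => (N ω ∩ (O ∩ B)).encard) inferInstance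
  have hmono : ∀ B, Monotone (fam B) := fun B F G hFG => biSup_mono fun O hO => hFG hO
  have hle : ∀ B, MeasurableSet B → ∀ F, fam B F ≤ ‹MeasurableSpace Ω› := fun B hB F =>
    iSup₂_le fun O _ => measurable_iff_comap_le.1 (hN.measurable_count _ (O.2.inter hB))
  have hsup : ∀ B, MeasurableSet B → countSigma N B = ⨆ F, fam B F := by
    intro B hB
    apply le_antisymm
    · refine countSigma_le_of_measurable fun O hO hOB => measurable_iff_comap_le.2 ?_
      refine le_trans ?_ (le_iSup (fam B) {⟨O, hO⟩})
      simp only [fam, Finset.mem_singleton, iSup_iSup_eq_left]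
      rw [inter_eq_left.2 hOB]
    · refine iSup_le fun F => iSup₂_le fun O _ => measurable_iff_comap_le.1 ?_
      exact measurable_count_of_subset (O.2.inter hB) inter_subset_right
  have key : ∀ F G, Indep (fam B F) (fam Bᶜ G) P := by
    -- Passing to `F ∪ G` lets both sides use the same partition into atoms.
    suffices ∀ F, Indep (fam B F) (fam Bᶜ F) P from fun F G =>
      indep_of_indep_of_le_left (indep_of_indep_of_le_right (this (F ∪ G))
        (hmono _ Finset.subset_union_right)) (hmono _ Finset.subset_union_left)
    intro F
    have hO : ∀ i : F, MeasurableSet (i : Set E) := fun i => i.1.2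
    have hind := hN.iIndepFun_atoms hO hB
    have h2 := indep_iSup_of_disjoint (S := {j | j.2 = True}) (T := {j | j.2 = False})
      (fun j => measurable_iff_comap_le.1 (hN.measurable_count _
        (measurableSet_partitionAtom hO hB j))) hind (by
        rw [Set.disjoint_left]
        intro j h1 h2
        exact true_ne_false (h1.symm.trans h2))
    refine indep_of_indep_of_le_left (indep_of_indep_of_le_right h2 ?_) ?_
    · refine iSup₂_le fun O hOF => measurable_iff_comap_le.1 ?_
      refine measurable_count_of_atoms (O := fun i : F => (i : Set E)) (B := Bᶜ)
        (fun ε => ?_) ⟨O, hOF⟩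
      have hatom : partitionAtom (fun i : F => (i : Set E)) Bᶜ (ε, True)
          = partitionAtom (fun i : F => (i : Set E)) B (ε, False) := by
        ext e
        simp [partitionAtom]
      rw [hatom]
      exact measurable_iff_comap_le.2 (le_iSup₂_of_le (ε, False) rfl le_rfl)
    · refine iSup₂_le fun O hOF => measurable_iff_comap_le.1 ?_
      refine measurable_count_of_atoms (O := fun i : F => (i : Set E))
        (fun ε => ?_) ⟨O, hOF⟩
      exact measurable_iff_comap_le.2 (le_iSup₂_of_le (ε, True) rfl le_rfl)
  rw [hsup B hB, hsup _ hB.compl]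
  refine indep_iSup_of_directed_le (fun F => ?_) (hle B hB)
    (iSup_le fun F => hle _ hB.compl F) (hmono B).directed_le
  exact (indep_iSup_of_directed_le (fun G => (key F G).symm) (hle _ hB.compl) (hle B hB F)
    (hmono _).directed_le).symm

end CountSigma

/-! ### Probabilities of Poisson counts -/

section ExtPoisson

theorem extPoisson_singleton {r : ℝ≥0∞} (hr : r ≠ ∞) (n : ℕ) :
    extPoisson r {(n : ℕ∞)}
      = ENNReal.ofReal (Real.exp (-r.toReal) * r.toReal ^ n / n.factorial) := by
  rw [extPoisson, if_neg hr, Measure.map_apply (by fun_prop) (measurableSet_singleton _)]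
  have : (fun n : ℕ => (n : ℕ∞)) ⁻¹' {(n : ℕ∞)} = {n} := by ext; simp
  rw [this, poissonMeasure_singleton]
  rfl

variable {Ω E : Type*} [MeasurableSpace E] {N : Ω → Set E} [MeasurableSpace Ω] {P : Measure Ω}
  {Λ : Measure E}

theorem IsPoissonProcess.prob_count_eq (hN : IsPoissonProcess N Λ P) {B : Set E}
    (hB : MeasurableSet B) (hΛ : Λ B ≠ ∞) (n : ℕ) :
    P {ω | (N ω ∩ B).encard = n}
      = ENNReal.ofReal (Real.exp (-(Λ B).toReal) * (Λ B).toReal ^ n / n.factorial) := by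
  rw [← extPoisson_singleton hΛ, ← hN.count_law B hB,
    Measure.map_apply (hN.measurable_count B hB) (measurableSet_singleton _)]
  rfl

theorem IsPoissonProcess.ae_finite (hN : IsPoissonProcess N Λ P) {B : Set E}
    (hB : MeasurableSet B) (hΛ : Λ B ≠ ∞) : ∀ᵐ ω ∂P, (N ω ∩ B).Finite := by
  have h : ∀ᵐ n ∂(P.map fun ω => (N ω ∩ B).encard), n ≠ (⊤ : ℕ∞) := by
    rw [hN.count_law B hB, extPoisson, if_neg hΛ, ae_map_iff (by fun_prop) (by measurability)]
    simp
  filter_upwards [ae_of_ae_map (hN.measurable_count B hB).aemeasurable h] with ω hω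
  exact encard_ne_top_iff.1 hω

theorem IsPoissonProcess.ae_infinite (hN : IsPoissonProcess N Λ P) {B : Set E}
    (hB : MeasurableSet B) (hΛ : Λ B = ∞) : ∀ᵐ ω ∂P, (N ω ∩ B).Infinite := by
  have h : ∀ᵐ n ∂(P.map fun ω => (N ω ∩ B).encard), n = (⊤ : ℕ∞) := by
    rw [hN.count_law B hB, extPoisson, if_pos hΛ, ae_dirac_iff (by measurability)]
  filter_upwards [ae_of_ae_map (hN.measurable_count B hB).aemeasurable h] with ω hω
  exact encard_eq_top_iff.1 hω

/-- The probability of at least two points in a set of intensity `r` is at most `r²`. -/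
theorem IsPoissonProcess.prob_two_le (hN : IsPoissonProcess N Λ P) [IsProbabilityMeasure P]
    {B : Set E} (hB : MeasurableSet B) (hΛ : Λ B ≠ ∞) :
    P {ω | 1 < (N ω ∩ B).encard} ≤ Λ B ^ 2 := by
  set r := (Λ B).toReal with hr
  have hr0 : 0 ≤ r := ENNReal.toReal_nonneg
  have h0 := hN.prob_count_eq hB hΛ 0
  have h1 := hN.prob_count_eq hB hΛ 1
  have hm : ∀ n : ℕ, MeasurableSet {ω | (N ω ∩ B).encard = n} := fun n =>
    hN.measurable_count B hB (measurableSet_singleton (n : ℕ∞))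
  have hset : {ω | 1 < (N ω ∩ B).encard}
      = ({ω | (N ω ∩ B).encard = (0 : ℕ)} ∪ {ω | (N ω ∩ B).encard = (1 : ℕ)})ᶜ := by
    ext ω
    simp only [mem_ofPred_eq, mem_compl_iff, mem_union, not_or, Nat.cast_zero, Nat.cast_one]
    rw [← ne_eq, ← ne_eq, ← Order.one_le_iff_ne_zero]
    constructor
    · intro h
      exact ⟨h.le, h.ne'⟩
    · rintro ⟨h, h'⟩
      exact lt_of_le_of_ne h h'.symm
  have hsq : Λ B ^ 2 = ENNReal.ofReal (r ^ 2) := by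
    rw [ENNReal.ofReal_pow hr0, ENNReal.ofReal_toReal hΛ]
  rw [hset, prob_compl_eq_one_sub ((hm 0).union (hm 1)), measure_union _ (hm 1), h0, h1,
    ← hr, hsq, ← ENNReal.ofReal_add (by positivity) (by positivity), ← ENNReal.ofReal_one,
    ← ENNReal.ofReal_sub _ (by positivity)]
  · apply ENNReal.ofReal_le_ofReal
    -- From `exp (-r) ≥ 1 - r`, the probability `1 - exp (-r) (1 + r)` is at most `1 - (1 - r)(1 +
    -- r) = r²`.
    have := Real.add_one_le_exp (-r)
    simp only [Nat.factorial_zero, Nat.factorial_one, pow_zero, pow_one, Nat.cast_one, div_one,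
      mul_one]
    nlinarith
  · refine Set.disjoint_left.2 fun ω h h' => ?_
    have := h.symm.trans h'
    norm_num at this

end ExtPoisson

/-! ### Dyadic numbers and cells -/

/-- The dyadic numbers. -/
def dyadics : Set ℝ := range fun q : ℕ × ℤ => (q.2 : ℝ) / 2 ^ q.1

theorem countable_dyadics : dyadics.Countable := countable_range _

theorem exists_pow_two_inv_lt {ε : ℝ} (hε : 0 < ε) : ∀ᶠ n : ℕ in atTop, 1 / (2 : ℝ) ^ n < ε := by
  have h : Tendsto (fun n : ℕ => 1 / (2 : ℝ) ^ n) atTop (𝓝 0) := by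
    simpa [one_div, inv_pow] using
      tendsto_pow_atTop_nhds_zero_of_lt_one (r := (2 : ℝ)⁻¹) (by norm_num) (by norm_num)
  exact h.eventually_lt_const hε

theorem dense_dyadics : Dense dyadics := by
  refine dense_of_exists_between fun a b hab => ?_
  obtain ⟨n, hn⟩ := (exists_pow_two_inv_lt (sub_pos.2 hab)).exists
  have h2 : (0 : ℝ) < 2 ^ n := by positivity
  refine ⟨_, ⟨(n, ⌊a * 2 ^ n⌋ + 1), rfl⟩, ?_, ?_⟩
  · rw [lt_div_iff₀ h2]
    push_cast
    exact Int.lt_floor_add_one _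
  · have h3 : (⌊a * 2 ^ n⌋ : ℝ) ≤ a * 2 ^ n := Int.floor_le _
    rw [div_lt_iff₀ h2]
    rw [div_lt_iff₀ h2] at hn
    push_cast
    nlinarith

/-- The dyadic interval `[j 2⁻ⁿ, (j + 1) 2⁻ⁿ)`. -/
def cell (n j : ℕ) : Set ℝ := Ico ((j : ℝ) / 2 ^ n) (((j : ℝ) + 1) / 2 ^ n)

theorem mem_cell_iff {n j : ℕ} {t : ℝ} (ht : 0 ≤ t) : t ∈ cell n j ↔ ⌊t * 2 ^ n⌋₊ = j := by
  have h2 : (0 : ℝ) < 2 ^ n := by positivity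
  rw [Nat.floor_eq_iff (by positivity), cell, mem_Ico, div_le_iff₀ h2, lt_div_iff₀ h2]

theorem cell_nonneg {n j : ℕ} {t : ℝ} (ht : t ∈ cell n j) : 0 ≤ t :=
  le_trans (by positivity) ht.1

theorem measurableSet_cell (n j : ℕ) : MeasurableSet (cell n j) := measurableSet_Ico

theorem volume_cell (n j : ℕ) :
    (volume.restrict (Ici (0 : ℝ))) (cell n j) = (2 ^ n)⁻¹ := by
  rw [Measure.restrict_apply (measurableSet_cell n j),
    inter_eq_left.2 (show cell n j ⊆ Ici 0 from fun t ht => cell_nonneg ht), cell, Real.volume_Ico,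
    ← sub_div, add_sub_cancel_left, one_div, ENNReal.ofReal_inv_of_pos (by positivity),
    ENNReal.ofReal_pow (by norm_num)]
  simp

/-! ### Measurable sequences of marks -/

section Marks

variable {Ω K : Type*} [MeasurableSpace Ω] [MeasurableSpace K] {P : Measure Ω}
  [IsProbabilityMeasure P] {κ : Measure K} [SFinite κ] {N : Ω → Set (ℝ × K)} {V : Set K}

/-- Only the distinctness of the times needs an argument. Two points before `T` with equal times
share a cell at every level `n`. There are `T * 2 ^ n` cells, each containing two points with
probability at most `(κ V / 2 ^ n) ^ 2`, and the total vanishes as `n → ∞`. -/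
theorem ae_isTimeConfig (hN : IsPoissonProcess N ((volume.restrict (Ici (0 : ℝ))).prod κ) P)
    (hV : MeasurableSet V) (hV0 : κ V ≠ 0) (hVtop : κ V ≠ ∞) :
    ∀ᵐ ω ∂P, IsTimeConfig (N ω ∩ Ici 0 ×ˢ V) := by
  have hfin : ∀ᵐ ω ∂P, ∀ n : ℕ, (N ω ∩ Ico 0 (n : ℝ) ×ˢ V).Finite := by
    refine ae_all_iff.2 fun n => hN.ae_finite (measurableSet_Ico.prod hV) ?_
    rw [Measure.prod_prod]
    refine ENNReal.mul_ne_top (ne_top_of_le_ne_top ?_ (Measure.restrict_apply_le _ _)) hVtop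
    simp
  have hinf : ∀ᵐ ω ∂P, (N ω ∩ Ici (0 : ℝ) ×ˢ V).Infinite := by
    refine hN.ae_infinite (measurableSet_Ici.prod hV) ?_
    rw [Measure.prod_prod]
    simp [hV0]
  have hinj : ∀ T : ℕ, ∀ᵐ ω ∂P, InjOn Prod.fst (N ω ∩ Ico 0 (T : ℝ) ×ˢ V) := by
    intro T
    have hb : ∀ n : ℕ, P {ω | ¬ InjOn Prod.fst (N ω ∩ Ico 0 (T : ℝ) ×ˢ V)}
        ≤ T * κ V ^ 2 * (2 ^ n)⁻¹ := by
      intro n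
      have hsub : {ω | ¬ InjOn Prod.fst (N ω ∩ Ico 0 (T : ℝ) ×ˢ V)}
          ⊆ ⋃ j ∈ Finset.range (T * 2 ^ n), {ω | 1 < (N ω ∩ cell n j ×ˢ V).encard} := by
        intro ω hω
        simp only [InjOn, mem_ofPred_eq, not_forall] at hω
        obtain ⟨p, hp, q, hq, hpq, hne⟩ := hω
        have hp0 : 0 ≤ p.1 := hp.2.1.1
        simp only [mem_iUnion, Finset.mem_range, exists_prop, mem_ofPred_eq]
        refine ⟨⌊p.1 * 2 ^ n⌋₊, ?_, ?_⟩
        · rw [Nat.floor_lt (by positivity)]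
          push_cast
          exact mul_lt_mul_of_pos_right hp.2.1.2 (by positivity)
        · rw [one_lt_encard_iff]
          exact ⟨p, q, ⟨hp.1, (mem_cell_iff hp0).2 rfl, hp.2.2⟩,
            ⟨hq.1, (mem_cell_iff (hpq ▸ hp0)).2 (by rw [hpq]), hq.2.2⟩, hne⟩
      have hΛ : ∀ j, ((volume.restrict (Ici (0 : ℝ))).prod κ) (cell n j ×ˢ V)
          = (2 ^ n)⁻¹ * κ V := fun j => by rw [Measure.prod_prod, volume_cell]
      have h2 : ((2 : ℝ≥0∞) ^ n)⁻¹ ≠ ∞ := by simp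
      calc _ ≤ _ := measure_mono hsub
        _ ≤ ∑ j ∈ Finset.range (T * 2 ^ n), P {ω | 1 < (N ω ∩ cell n j ×ˢ V).encard} :=
          measure_biUnion_finset_le _ _
        _ ≤ ∑ j ∈ Finset.range (T * 2 ^ n), ((2 ^ n)⁻¹ * κ V) ^ 2 := by
          refine Finset.sum_le_sum fun j _ => ?_
          rw [← hΛ j]
          exact hN.prob_two_le (measurableSet_Ico.prod hV)
            (by rw [hΛ]; exact ENNReal.mul_ne_top h2 hVtop)
        _ = T * κ V ^ 2 * (2 ^ n)⁻¹ := by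
          have h1 : (2 : ℝ≥0∞) ^ n * (2 ^ n)⁻¹ = 1 :=
            ENNReal.mul_inv_cancel (by simp) (by simp)
          rw [Finset.sum_const, Finset.card_range, nsmul_eq_mul]
          push_cast
          calc (T * 2 ^ n * ((2 ^ n)⁻¹ * κ V) ^ 2 : ℝ≥0∞)
              = T * κ V ^ 2 * (2 ^ n)⁻¹ * (2 ^ n * (2 ^ n)⁻¹) := by ring
            _ = _ := by rw [h1, mul_one]
    have hlim : Tendsto (fun n : ℕ => T * κ V ^ 2 * ((2 : ℝ≥0∞) ^ n)⁻¹) atTop (𝓝 0) := by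
      have h := ENNReal.Tendsto.const_mul (a := T * κ V ^ 2)
        (ENNReal.tendsto_pow_atTop_nhds_zero_of_lt_one (r := 2⁻¹) (by simp))
        (Or.inr (ENNReal.mul_ne_top (by simp) (by finiteness)))
      simpa [ENNReal.inv_pow] using h
    exact le_antisymm (ge_of_tendsto' hlim hb) zero_le
  filter_upwards [hfin, hinf, ae_all_iff.2 hinj] with ω h1 h2 h3
  refine ⟨fun t => ?_, fun p hp q hq hpq => ?_, h2⟩
  · obtain ⟨n, hn⟩ := exists_nat_gt t
    exact (h1 n).subset fun p hp => ⟨hp.1.1, ⟨hp.1.2.1, lt_trans hp.2 hn⟩, hp.1.2.2⟩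
  · obtain ⟨n, hn⟩ := exists_nat_gt p.1
    exact h3 n ⟨hp.1, ⟨hp.2.1, hn⟩, hp.2.2⟩ ⟨hq.1, ⟨hq.2.1, hpq ▸ hn⟩, hq.2.2⟩ hpq

/-- `y` is a sequence of random marks, almost surely the marks of the points of `N` in
`[0, ∞) × V`, in the order of increasing times. -/
structure IsMarkSeq (P : Measure Ω) (N : Ω → Set (ℝ × K)) (V : Set K) (y : ℕ → Ω → K) : Prop where
  measurable : ∀ k, Measurable (y k)
  ae_enumerates : ∀ᵐ ω ∂P, ∃ p, Enumerates p (N ω ∩ Ici 0 ×ˢ V) ∧ ∀ k, y k ω = (p k).2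

theorem inter_strip_before {Ω K : Type*} {N : Ω → Set (ℝ × K)} {V : Set K} (ω : Ω) (a : ℝ) :
    N ω ∩ Ici 0 ×ˢ V ∩ Iio a ×ˢ univ = N ω ∩ Ico 0 a ×ˢ V := by
  ext q
  simp only [mem_inter_iff, mem_prod, mem_Ici, mem_Iio, mem_Ico, mem_univ, and_true]
  tauto

theorem inter_strip_Ico {Ω K : Type*} {N : Ω → Set (ℝ × K)} {V : Set K} (ω : Ω) (a b : ℝ)
    (E : Set K) :
    N ω ∩ Ici 0 ×ˢ V ∩ Ico a b ×ˢ E = N ω ∩ (Ici 0 ∩ Ico a b) ×ˢ (V ∩ E) := by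
  ext q
  simp only [mem_inter_iff, mem_prod]
  tauto

/-- The event that the `k`-th mark lies in `E`, described by numbers of points in the region
before time `c`. -/
def markEvent {Ω K : Type*} (N : Ω → Set (ℝ × K)) (V : Set K) (k : ℕ) (E : Set K)
    (I : Set ℝ) : Set Ω :=
  ⋃ a ∈ dyadics ∩ I, ⋃ b ∈ dyadics ∩ I,
    {ω | (N ω ∩ Ico 0 a ×ˢ V).encard = k} ∩
      ({ω | (N ω ∩ (Ici 0 ∩ Ico a b) ×ˢ V).encard = 1} ∩
        {ω | (N ω ∩ (Ici 0 ∩ Ico a b) ×ˢ (V ∩ E)).encard = 1})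

theorem mem_markEvent {Ω K : Type*} {N : Ω → Set (ℝ × K)} {V : Set K} {k : ℕ} {E : Set K}
    {I : Set ℝ} {ω : Ω} {p : ℕ → ℝ × K}
    (hp : Enumerates p (N ω ∩ Ici 0 ×ˢ V)) (hI : I = univ ∨ ∃ c, I = Iic c ∧ (p k).1 < c) :
    ω ∈ markEvent N V k E I ↔ (p k).2 ∈ E := by
  have hV : ∀ J : Set ℝ, N ω ∩ J ×ˢ V = N ω ∩ J ×ˢ (V ∩ univ) := fun J => by rw [inter_univ]
  simp only [markEvent, mem_iUnion, exists_prop, mem_inter_iff, mem_ofPred_eq,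
    ← inter_strip_before]
  simp only [hV (Ici 0 ∩ _), ← inter_strip_Ico]
  rcases hI with rfl | ⟨c, rfl, hc⟩
  · rw [hp.mark_mem_iff dense_dyadics]
    simp
  · rw [hp.mark_mem_iff_of_lt dense_dyadics _ hc]
    constructor
    · rintro ⟨a, ⟨ha, hac⟩, b, ⟨hb, hbc⟩, h⟩
      exact ⟨a, ha, b, hb, hac, hbc, h⟩
    · rintro ⟨a, ha, b, hb, hac, hbc, h⟩
      exact ⟨a, ⟨ha, hac⟩, b, ⟨hb, hbc⟩, h⟩

theorem measurableSet_markEvent {Ω K : Type*} {N : Ω → Set (ℝ × K)} {V : Set K}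
    {m : MeasurableSpace Ω} {k : ℕ} {E : Set K} {I : Set ℝ}
    (h1 : ∀ a ∈ dyadics ∩ I, Measurable[m] fun ω => (N ω ∩ Ico 0 a ×ˢ V).encard)
    (h2 : ∀ a ∈ dyadics ∩ I, ∀ b ∈ dyadics ∩ I,
      Measurable[m] fun ω => (N ω ∩ (Ici 0 ∩ Ico a b) ×ˢ V).encard)
    (h3 : ∀ a ∈ dyadics ∩ I, ∀ b ∈ dyadics ∩ I,
      Measurable[m] fun ω => (N ω ∩ (Ici 0 ∩ Ico a b) ×ˢ (V ∩ E)).encard) :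
    MeasurableSet[m] (markEvent N V k E I) := by
  have hc : (dyadics ∩ I).Countable := countable_dyadics.mono inter_subset_left
  refine MeasurableSet.biUnion hc fun a ha => MeasurableSet.biUnion hc fun b hb => ?_
  exact (h1 a ha (measurableSet_singleton (k : ℕ∞))).inter
    ((h2 a ha b hb (measurableSet_singleton (1 : ℕ∞))).inter
      (h3 a ha b hb (measurableSet_singleton (1 : ℕ∞))))

theorem IsPoissonProcess.exists_isMarkSeq [Nonempty K]
    (hN : IsPoissonProcess N ((volume.restrict (Ici (0 : ℝ))).prod κ) P)
    (hV : MeasurableSet V) (hV0 : κ V ≠ 0) (hVtop : κ V ≠ ∞) : ∃ y, IsMarkSeq P N V y := by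
  classical
  obtain ⟨B, hB, hBm, hB0⟩ := exists_measurable_superset_of_null
    (ae_iff.1 (ae_isTimeConfig hN hV hV0 hVtop))
  have hgood : ∀ ω ∉ B, ∃ p, Enumerates p (N ω ∩ Ici 0 ×ˢ V) := fun ω hω =>
    IsTimeConfig.exists_enumerates (not_not.1 fun h => hω (hB h))
  choose! p hp using hgood
  obtain ⟨y₀⟩ := ‹Nonempty K›
  refine ⟨fun k ω => if ω ∈ B then y₀ else (p ω k).2, fun k E hE => ?_, ?_⟩
  · have hset : (fun ω => if ω ∈ B then y₀ else (p ω k).2) ⁻¹' E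
        = (B ∩ {_ω | y₀ ∈ E}) ∪ (Bᶜ ∩ markEvent N V k E univ) := by
      ext ω
      by_cases hω : ω ∈ B
      · simp [hω]
      · simp [hω, mem_markEvent (hp ω hω) (Or.inl rfl)]
    rw [hset]
    refine (hBm.inter (MeasurableSet.const _)).union (hBm.compl.inter ?_)
    refine measurableSet_markEvent (fun a _ => ?_) (fun a _ b _ => ?_) (fun a _ b _ => ?_)
    · exact hN.measurable_count _ (measurableSet_Ico.prod hV)
    · exact hN.measurable_count _ ((measurableSet_Ici.inter measurableSet_Ico).prod hV)
    · exact hN.measurable_count _ ((measurableSet_Ici.inter measurableSet_Ico).prod (hV.inter hE))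
  · filter_upwards [compl_mem_ae_iff.2 hB0] with ω hω
    exact ⟨p ω, hp ω hω, fun k => if_neg hω⟩

/-- The event that the `k`-th mark lies in `E` is measurable, up to null sets, with respect to any
σ-algebra for which the relevant numbers of points are. -/
theorem IsMarkSeq.measurableSet_of_counts {Ω K : Type*} {m mΩ : MeasurableSpace Ω}
    [MeasurableSpace K] {P : Measure Ω} {N : Ω → Set (ℝ × K)} {V : Set K}
    {y : ℕ → Ω → K} (hy : IsMarkSeq P N V y) {E : Set K}
    (h0 : ∀ a ∈ dyadics, Measurable[eventuallyMeasurableSpace m (ae P)]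
        fun ω => (N ω ∩ Ico 0 a ×ˢ V).encard)
    (h1 : ∀ a ∈ dyadics, ∀ b ∈ dyadics, Measurable[eventuallyMeasurableSpace m (ae P)]
        fun ω => (N ω ∩ (Ici 0 ∩ Ico a b) ×ˢ V).encard)
    (h2 : ∀ a ∈ dyadics, ∀ b ∈ dyadics, Measurable[eventuallyMeasurableSpace m (ae P)]
        fun ω => (N ω ∩ (Ici 0 ∩ Ico a b) ×ˢ (V ∩ E)).encard) (k : ℕ) :
    MeasurableSet[eventuallyMeasurableSpace m (ae P)] (y k ⁻¹' E) := by
  have hme : MeasurableSet[eventuallyMeasurableSpace m (ae P)] (markEvent N V k E univ) :=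
    measurableSet_markEvent (fun a ha => h0 a ha.1) (fun a ha b hb => h1 a ha.1 b hb.1)
      (fun a ha b hb => h2 a ha.1 b hb.1)
  refine EventuallyMeasurableSet.congr hme ?_
  filter_upwards [hy.ae_enumerates] with ω hω
  obtain ⟨p, hp, hyp⟩ := hω
  have := mem_markEvent (k := k) (E := E) hp (Or.inl rfl)
  rw [← hyp] at this
  exact propext this.symm

theorem measurable_apply_of_countable {Ω ι β : Type*} {m : MeasurableSpace Ω} [MeasurableSpace β]
    [MeasurableSpace ι] [Countable ι] [MeasurableSingletonClass ι] {c : ι → Ω → β}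
    (hc : ∀ i, Measurable (c i)) {f : Ω → ι} (hf : Measurable f) :
    Measurable fun ω => c (f ω) ω := by
  have h : Measurable fun q : Ω × ι => c q.2 q.1 := measurable_from_prod_countable_left hc
  exact h.comp (measurable_id.prodMk hf)

/-- Conversely, the numbers of points in a dyadic interval with marks in `E` are determined by the
marks and the numbers of points in the dyadic intervals. -/
theorem IsMarkSeq.measurable_count {Ω K : Type*} {m mΩ : MeasurableSpace Ω}
    [MeasurableSpace K] {P : Measure Ω} {N : Ω → Set (ℝ × K)} {V : Set K}
    {y : ℕ → Ω → K} (hy : IsMarkSeq P N V y) {E : Set K}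
    (hE : ∀ k, MeasurableSet[eventuallyMeasurableSpace m (ae P)] (y k ⁻¹' E))
    (h0 : ∀ a ∈ dyadics, Measurable[eventuallyMeasurableSpace m (ae P)]
        fun ω => (N ω ∩ Ico 0 a ×ˢ V).encard) {a b : ℝ} (ha : a ∈ dyadics) (hb : b ∈ dyadics) :
    Measurable[eventuallyMeasurableSpace m (ae P)]
        fun ω => (N ω ∩ (Ici 0 ∩ Ico a b) ×ˢ (V ∩ E)).encard := by
  classical
  -- For fixed index bounds `q` this counts the marks in `E`. The random bounds are the numbers of
  -- points before `a` and `b`, inserted afterwards; `ℕ∞ × ℕ∞` is countable, so measurability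
  -- survives. Almost surely both bounds are finite, so `toNat` loses nothing.
  let c : ℕ∞ × ℕ∞ → Ω → ℕ∞ := fun q ω =>
    ∑ k ∈ Finset.Ico q.1.toNat q.2.toNat, (y k ⁻¹' E).indicator (fun _ => 1) ω
  have hc : ∀ q, Measurable[eventuallyMeasurableSpace m (ae P)] (c q) := fun q =>
    Finset.measurable_fun_sum _ fun k _ => measurable_const.indicator (hE k)
  have hm := measurable_apply_of_countable hc ((h0 a ha).prodMk (h0 b hb))
  refine EventuallyMeasurable.congr hm ?_
  filter_upwards [hy.ae_enumerates] with ω hω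
  obtain ⟨p, hp, hyp⟩ := hω
  obtain ⟨i, hi⟩ := hp.exists_index a
  obtain ⟨j, hj⟩ := hp.exists_index b
  have h1 := hp.encard_before hi
  have h2 := hp.encard_before hj
  rw [inter_strip_before] at h1 h2
  rw [← inter_strip_Ico, hp.encard_Ico hi hj]
  simp only [c, h1, h2, ENat.toNat_natCast]
  have hset : {k | i ≤ k ∧ k < j ∧ (p k).2 ∈ E}
      = ↑((Finset.Ico i j).filter fun k => (p k).2 ∈ E) := by
    ext k
    simp [and_assoc]
  rw [hset, encard_coe_eq_coe_finsetCard, Finset.card_filter]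
  push_cast
  refine Finset.sum_congr rfl fun k _ => ?_
  simp [indicator, hyp]

end Marks

/-! ### Grid counts and their traces -/

/-- The sets that agree on `H` with a set of the σ-algebra `m`. -/
@[reducible] def traceSigma {Ω : Type*} (m : MeasurableSpace Ω) (H : Set Ω) : MeasurableSpace Ω :=
  (m.comap (Subtype.val : H → Ω)).map Subtype.val

theorem measurableSet_traceSigma {Ω : Type*} {m : MeasurableSpace Ω} {H D : Set Ω} :
    MeasurableSet[traceSigma m H] D ↔ ∃ D', MeasurableSet[m] D' ∧ D ∩ H = D' ∩ H := by
  constructor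
  · rintro ⟨D', hD', h⟩
    exact ⟨D', hD', (Subtype.preimage_val_eq_preimage_val_iff _ _ _).1 h.symm |> fun h => by
      rw [inter_comm D, inter_comm D', h]⟩
  · rintro ⟨D', hD', h⟩
    refine ⟨D', hD', (Subtype.preimage_val_eq_preimage_val_iff _ _ _).2 ?_⟩
    rw [inter_comm H, inter_comm H, h]

theorem measurable_traceSigma_of_eqOn {Ω α : Type*} [MeasurableSpace α] {m : MeasurableSpace Ω}
    {H : Set Ω} {f g : Ω → α} (hg : Measurable[m] g) (hfg : EqOn f g H) :
    Measurable[traceSigma m H] f := by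
  refine fun A hA => measurableSet_traceSigma.2 ⟨g ⁻¹' A, hg hA, ?_⟩
  ext ω
  simp only [mem_inter_iff, mem_preimage]
  exact and_congr_left fun hω => by rw [hfg hω]

/-- The σ-algebra generated by the numbers of points in `[0, j 2⁻ⁿ) × V` and by the points
outside the region `[0, ∞) × V`. -/
@[reducible] def gridSigma {Ω K : Type*} [MeasurableSpace K] (N : Ω → Set (ℝ × K)) (V : Set K)
    (n : ℕ) : MeasurableSpace Ω :=
  (⨆ j : ℤ, MeasurableSpace.comap (fun ω => (N ω ∩ Ico 0 ((j : ℝ) / 2 ^ n) ×ˢ V).encard)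
    inferInstance) ⊔ countSigma N (Ici 0 ×ˢ V)ᶜ

section Grid

variable {Ω K : Type*} [MeasurableSpace K] {N : Ω → Set (ℝ × K)} {V : Set K}

theorem measurable_grid_count (n : ℕ) (j : ℤ) :
    Measurable[gridSigma N V n] fun ω => (N ω ∩ Ico 0 ((j : ℝ) / 2 ^ n) ×ˢ V).encard :=
  measurable_iff_comap_le.2 (le_sup_of_le_left (le_iSup (fun j : ℤ => MeasurableSpace.comap
    (fun ω => (N ω ∩ Ico 0 ((j : ℝ) / 2 ^ n) ×ˢ V).encard) inferInstance) j))

theorem gridSigma_le {n : ℕ} {m : MeasurableSpace Ω}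
    (h : ∀ j : ℤ, Measurable[m] fun ω => (N ω ∩ Ico 0 ((j : ℝ) / 2 ^ n) ×ˢ V).encard)
    (h' : countSigma N (Ici 0 ×ˢ V)ᶜ ≤ m) : gridSigma N V n ≤ m :=
  sup_le (iSup_le fun j => measurable_iff_comap_le.1 (h j)) h'

/-- Each grid time of level `n` is a grid time of level `m ≥ n`, with numerator multiplied by `2 ^
(m - n)`. -/
theorem gridSigma_mono : Monotone (gridSigma N V) := by
  intro n m hnm
  refine gridSigma_le (fun j => ?_) le_sup_right
  have h := measurable_grid_count (N := N) (V := V) m (j * 2 ^ (m - n))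
  have hj : (((j * 2 ^ (m - n) : ℤ) : ℝ)) / 2 ^ m = (j : ℝ) / 2 ^ n := by
    rw [← Nat.add_sub_cancel' hnm, Nat.add_sub_cancel_left, pow_add]
    push_cast
    field_simp
  rwa [hj] at h

/-- Once the cell is known to hold exactly one point, a grid count up to a time beyond the cell is
the count off the cell plus one, and an earlier grid count avoids the cell. So on `H` the cell
contributes no further information. -/
theorem gridSigma_le_traceSigma (hV : MeasurableSet V) {n j : ℕ} {H : Set Ω}
    (hH : ∀ ω ∈ H, (N ω ∩ cell n j ×ˢ V).encard = 1) :
    gridSigma N V n ≤ traceSigma (countSigma N (cell n j ×ˢ V)ᶜ) H := by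
  have hsub : cell n j ×ˢ V ⊆ Ici 0 ×ˢ V := prod_mono (fun t ht => cell_nonneg ht) le_rfl
  have hle : countSigma N (cell n j ×ˢ V)ᶜ ≤ traceSigma (countSigma N (cell n j ×ˢ V)ᶜ) H :=
    fun D hD => measurableSet_traceSigma.2 ⟨D, hD, rfl⟩
  refine gridSigma_le (fun i => ?_) ((countSigma_mono (compl_subset_compl.2 hsub)).trans hle)
  have h2 : (0 : ℝ) < 2 ^ n := by positivity
  rcases le_or_gt i (j : ℤ) with hij | hij
  · refine Measurable.mono (measurable_count_of_subset (measurableSet_Ico.prod hV) ?_) hle le_rfl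
    rintro q hq hq'
    have hij' : (i : ℝ) ≤ j := by exact_mod_cast hij
    have : (i : ℝ) / 2 ^ n ≤ j / 2 ^ n := by gcongr
    exact absurd (hq'.1.1.trans_lt hq.1.2) (not_lt.2 this)
  · have hij' : (j : ℝ) + 1 ≤ i := by exact_mod_cast hij
    have hcell : cell n j ⊆ Ico 0 ((i : ℝ) / 2 ^ n) := fun t ht =>
      ⟨cell_nonneg ht, ht.2.trans_le (by gcongr)⟩
    refine measurable_traceSigma_of_eqOn
      (g := fun ω => (N ω ∩ (Ico 0 ((i : ℝ) / 2 ^ n) \ cell n j) ×ˢ V).encard + 1) ?_ ?_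
    · refine Measurable.add_const (measurable_count_of_subset
        ((measurableSet_Ico.diff (measurableSet_cell n j)).prod hV) ?_) 1
      intro q hq hq'
      exact hq.1.2 hq'.1
    · intro ω hω
      beta_reduce
      rw [← hH ω hω, ← encard_union_eq]
      · congr 1
        rw [← inter_union_distrib_left, ← union_prod, sdiff_union_of_subset hcell]
      · refine Set.disjoint_left.2 fun q hq hq' => hq.2.1.2 hq'.2.1

end Grid

theorem gridSigma_le_of_isPoissonProcess {Ω K : Type*} [MeasurableSpace Ω]
    [MeasurableSpace K] {P : Measure Ω} {Λ : Measure (ℝ × K)} {N : Ω → Set (ℝ × K)} {V : Set K}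
    (hN : IsPoissonProcess N Λ P)
    (hV : MeasurableSet V) (n : ℕ) : gridSigma N V n ≤ ‹MeasurableSpace Ω› :=
  gridSigma_le (fun _ => hN.measurable_count _ (measurableSet_Ico.prod hV))
    (hN.countSigma_le _)

/-! ### The marks are i.i.d. and independent of the outer σ-algebra -/

section Step

variable {Ω K : Type*} [MeasurableSpace Ω] [MeasurableSpace K] {P : Measure Ω}
  [IsProbabilityMeasure P] {κ : Measure K} [SFinite κ] {N : Ω → Set (ℝ × K)} {V : Set K}

/-- The mark of a point that is alone in a cell has the normalised intensity as its law. -/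
theorem prob_isolated_mark (hN : IsPoissonProcess N ((volume.restrict (Ici (0 : ℝ))).prod κ) P)
    (hV : MeasurableSet V) (hV0 : κ V ≠ 0) (hVtop : κ V ≠ ∞) {E : Set K} (hE : MeasurableSet E)
    (n j : ℕ) :
    P ({ω | (N ω ∩ cell n j ×ˢ V).encard = 1} ∩ {ω | (N ω ∩ cell n j ×ˢ (V ∩ E)).encard = 1})
      = κ[|V] E * P {ω | (N ω ∩ cell n j ×ˢ V).encard = 1} := by
  have hset : {ω | (N ω ∩ cell n j ×ˢ V).encard = 1}
        ∩ {ω | (N ω ∩ cell n j ×ˢ (V ∩ E)).encard = 1}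
      = {ω | (N ω ∩ cell n j ×ˢ (V ∩ E)).encard = (1 : ℕ)}
        ∩ {ω | (N ω ∩ cell n j ×ˢ (V \ E)).encard = (0 : ℕ)} := by
    ext ω
    have hadd : (N ω ∩ cell n j ×ˢ V).encard
        = (N ω ∩ cell n j ×ˢ (V ∩ E)).encard + (N ω ∩ cell n j ×ˢ (V \ E)).encard := by
      rw [← encard_union_eq, ← inter_union_distrib_left, ← prod_union, inter_union_sdiff]
      exact Set.disjoint_left.2 fun q hq hq' => hq'.2.2.2 hq.2.2.2
    simp only [mem_inter_iff, mem_ofPred_eq, hadd, Nat.cast_one, Nat.cast_zero]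
    constructor
    · rintro ⟨h1, h2⟩
      rw [h2] at h1
      exact ⟨h2, by
        have hfin : (N ω ∩ cell n j ×ˢ (V \ E)).encard ≠ ⊤ := fun h => by simp [h] at h1
        lift (N ω ∩ cell n j ×ˢ (V \ E)).encard to ℕ using hfin with b
        norm_cast at h1 ⊢
        omega⟩
    · rintro ⟨h1, h2⟩
      rw [h1, h2]
      simp
  have hsub : cell n j ×ˢ (V \ E) ⊆ (cell n j ×ˢ (V ∩ E))ᶜ := fun q hq hq' => hq.2.2 hq'.2.2
  have hind := (Indep_iff _ _ _).1 (hN.indep_countSigma_compl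
    ((measurableSet_cell n j).prod (hV.inter hE)))
    {ω | (N ω ∩ cell n j ×ˢ (V ∩ E)).encard = (1 : ℕ)}
    {ω | (N ω ∩ cell n j ×ˢ (V \ E)).encard = (0 : ℕ)}
    (measurable_count_of_subset ((measurableSet_cell n j).prod (hV.inter hE)) le_rfl
      (measurableSet_singleton _))
    (measurable_count_of_subset ((measurableSet_cell n j).prod (hV.diff hE)) hsub
      (measurableSet_singleton _))
  have hΛ : ∀ A : Set K, ((volume.restrict (Ici (0 : ℝ))).prod κ) (cell n j ×ˢ A)
      = (2 ^ n)⁻¹ * κ A := fun A => by rw [Measure.prod_prod, volume_cell]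
  have h2 : ((2 : ℝ≥0∞) ^ n)⁻¹ ≠ ∞ := by simp
  have hEtop : κ (V ∩ E) ≠ ∞ := measure_ne_top_of_subset inter_subset_left hVtop
  have hE'top : κ (V \ E) ≠ ∞ := measure_ne_top_of_subset sdiff_subset hVtop
  have h1 := hN.prob_count_eq ((measurableSet_cell n j).prod hV)
    (by rw [hΛ]; exact ENNReal.mul_ne_top h2 hVtop) 1
  rw [hset, hind, hN.prob_count_eq ((measurableSet_cell n j).prod (hV.inter hE))
    (by rw [hΛ]; exact ENNReal.mul_ne_top h2 hEtop) 1,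
    hN.prob_count_eq ((measurableSet_cell n j).prod (hV.diff hE))
    (by rw [hΛ]; exact ENNReal.mul_ne_top h2 hE'top) 0]
  rw [Nat.cast_one] at h1
  rw [h1, cond_apply hV, hΛ, hΛ, hΛ, ← measure_inter_add_sdiff V hE]
  rw [← measure_inter_add_sdiff V hE] at hV0 hVtop
  simp only [ENNReal.toReal_mul, ENNReal.toReal_inv, ENNReal.toReal_pow, ENNReal.toReal_ofNat,
    ENNReal.toReal_add hEtop hE'top]
  have hpos : 0 < (κ (V ∩ E)).toReal + (κ (V \ E)).toReal := by
    rw [← ENNReal.toReal_add hEtop hE'top]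
    exact ENNReal.toReal_pos hV0 hVtop
  rw [show (κ (V ∩ E) + κ (V \ E))⁻¹ * κ (V ∩ E)
      = ENNReal.ofReal (((κ (V ∩ E)).toReal + (κ (V \ E)).toReal)⁻¹ * (κ (V ∩ E)).toReal) by
    rw [← ENNReal.toReal_add hEtop hE'top, ← ENNReal.toReal_inv, ← ENNReal.toReal_mul,
      ENNReal.ofReal_toReal (ENNReal.mul_ne_top (ENNReal.inv_ne_top.2 hV0) hEtop)],
    ← ENNReal.ofReal_mul (by positivity), ← ENNReal.ofReal_mul (by positivity)]
  congr 1
  -- With `a`, `b` the intensities of the two parts of the cell, this is `exp (-a) a exp (-b) = a /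
  -- (a + b) · exp (-(a + b)) (a + b)`.
  rw [mul_add, neg_add, Real.exp_add]
  simp only [pow_one, pow_zero, Nat.factorial_one, Nat.factorial_zero, Nat.cast_one, div_one,
    mul_one]
  field_simp

/-- The part of the recursion step that takes place in a single cell. -/
theorem prob_mark_cell (hN : IsPoissonProcess N ((volume.restrict (Ici (0 : ℝ))).prod κ) P)
    (hV : MeasurableSet V) (hV0 : κ V ≠ 0) (hVtop : κ V ≠ ∞) {G : Set Ω} (hG : P Gᶜ = 0)
    {p : Ω → ℕ → ℝ × K} (hp : ∀ ω ∈ G, Enumerates (p ω) (N ω ∩ Ici 0 ×ˢ V))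
    {n j k : ℕ} {R R' : Set Ω} {E : Set K} (hE : MeasurableSet E)
    (hR' : MeasurableSet[countSigma N (cell n j ×ˢ V)ᶜ] R')
    (hRR' : R ∩ (G ∩ ({ω | (N ω ∩ Ico 0 ((j : ℝ) / 2 ^ n) ×ˢ V).encard = k}
        ∩ {ω | (N ω ∩ cell n j ×ˢ V).encard = 1}))
      = R' ∩ (G ∩ ({ω | (N ω ∩ Ico 0 ((j : ℝ) / 2 ^ n) ×ˢ V).encard = k}
        ∩ {ω | (N ω ∩ cell n j ×ˢ V).encard = 1}))) :
    P (R ∩ (G ∩ ({ω | (N ω ∩ Ico 0 ((j : ℝ) / 2 ^ n) ×ˢ V).encard = k}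
        ∩ {ω | (N ω ∩ cell n j ×ˢ V).encard = 1})) ∩ {ω | (p ω k).2 ∈ E})
      = κ[|V] E * P (R ∩ (G ∩ ({ω | (N ω ∩ Ico 0 ((j : ℝ) / 2 ^ n) ×ˢ V).encard = k}
        ∩ {ω | (N ω ∩ cell n j ×ˢ V).encard = 1}))) := by
  set H1 := {ω | (N ω ∩ Ico 0 ((j : ℝ) / 2 ^ n) ×ˢ V).encard = k} with hH1
  set H2 := {ω | (N ω ∩ cell n j ×ˢ V).encard = 1} with hH2
  set H3 := {ω | (N ω ∩ cell n j ×ˢ (V ∩ E)).encard = 1} with hH3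
  have hcap : Ici (0 : ℝ) ∩ Ico ((j : ℝ) / 2 ^ n) (((j : ℝ) + 1) / 2 ^ n) = cell n j :=
    inter_eq_right.2 fun t ht => cell_nonneg ht
  -- On `G ∩ H1 ∩ H2` the point in the cell is the `k`-th, so its mark can be tested by the count
  -- `H3`. The event then splits into a factor off the cell, `R' ∩ H1`, and a factor in the cell,
  -- `H2 ∩ H3`.
  have e1 : R ∩ (G ∩ (H1 ∩ H2)) ∩ {ω | (p ω k).2 ∈ E} = (R' ∩ H1) ∩ (H2 ∩ H3) ∩ G := by
    rw [hRR']
    ext ω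
    simp only [mem_inter_iff]
    have key : ω ∈ G → ω ∈ H1 → ω ∈ H2 → (ω ∈ H3 ↔ (p ω k).2 ∈ E) := by
      intro hωG hω1 hω2
      have h := ((hp ω hωG).isolated_iff (a := (j : ℝ) / 2 ^ n) (b := ((j : ℝ) + 1) / 2 ^ n)
        (k := k) E (by rw [inter_strip_before]; exact hω1)
        (by rw [inter_strip_Ico, hcap, inter_univ]; exact hω2)).2
      rw [inter_strip_Ico, hcap] at h
      exact h
    constructor
    · rintro ⟨⟨h1, h2, h3, h4⟩, h5⟩
      exact ⟨⟨⟨h1, h3⟩, h4, (key h2 h3 h4).2 h5⟩, h2⟩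
    · rintro ⟨⟨⟨h1, h3⟩, h4, h5⟩, h2⟩
      exact ⟨⟨h1, h2, h3, h4⟩, (key h2 h3 h4).1 h5⟩
  have e2 : R ∩ (G ∩ (H1 ∩ H2)) = (R' ∩ H1) ∩ H2 ∩ G := by
    rw [hRR']
    ext ω
    simp only [mem_inter_iff]
    tauto
  have hsub : Ico 0 ((j : ℝ) / 2 ^ n) ×ˢ V ⊆ (cell n j ×ˢ V)ᶜ := fun q hq hq' =>
    absurd hq.1.2 (not_lt.2 hq'.1.1)
  have hmeas : MeasurableSet[countSigma N (cell n j ×ˢ V)ᶜ] (R' ∩ H1) :=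
    MeasurableSet.inter hR' (measurable_count_of_subset (measurableSet_Ico.prod hV) hsub
      (measurableSet_singleton _))
  have hm2 : MeasurableSet[countSigma N (cell n j ×ˢ V)] H2 :=
    measurable_count_of_subset ((measurableSet_cell n j).prod hV) le_rfl
      (measurableSet_singleton _)
  have hm3 : MeasurableSet[countSigma N (cell n j ×ˢ V)] H3 :=
    measurable_count_of_subset ((measurableSet_cell n j).prod (hV.inter hE))
      (prod_mono le_rfl inter_subset_left) (measurableSet_singleton _)
  have hind := (Indep_iff _ _ _).1
    (hN.indep_countSigma_compl ((measurableSet_cell n j).prod hV)).symm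
  rw [e1, e2, measure_inter_conull hG, measure_inter_conull hG, hind _ _ hmeas hm2,
    hind _ _ hmeas (hm2.inter hm3), prob_isolated_mark hN hV hV0 hVtop hE]
  ring

/-- Recursion step: the `k`-th mark is independent of the grid counts, of the points outside the
region and of the previous marks. -/
theorem prob_mark_step (hN : IsPoissonProcess N ((volume.restrict (Ici (0 : ℝ))).prod κ) P)
    (hV : MeasurableSet V) (hV0 : κ V ≠ 0) (hVtop : κ V ≠ ∞) {y : ℕ → Ω → K}
    (hy : IsMarkSeq P N V y) {m : ℕ} {D : Set Ω} (hD : MeasurableSet[gridSigma N V m] D)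
    {E : ℕ → Set K} (hE : ∀ i, MeasurableSet (E i)) (k : ℕ) :
    P ((D ∩ ⋂ i < k, y i ⁻¹' E i) ∩ y k ⁻¹' E k)
      = κ[|V] (E k) * P (D ∩ ⋂ i < k, y i ⁻¹' E i) := by
  obtain ⟨B, hB, hBm, hB0⟩ := exists_measurable_superset_of_null (ae_iff.1 hy.ae_enumerates)
  have hex : ∀ ω ∈ Bᶜ, ∃ p, Enumerates p (N ω ∩ Ici 0 ×ˢ V) ∧ ∀ k, y k ω = (p k).2 :=
    fun ω hω => not_not.1 fun h => hω (hB h)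
  set G := Bᶜ with hG
  have hGm : MeasurableSet G := hBm.compl
  have hG0 : P Gᶜ = 0 := by rwa [hG, compl_compl]
  have : Nonempty K := ⟨(nonempty_of_measure_ne_zero hV0).some⟩
  choose! p hp using hex
  set R := D ∩ ⋂ i < k, y i ⁻¹' E i with hR
  have hRm : MeasurableSet R := (gridSigma_le_of_isPoissonProcess hN hV m D hD).inter
    (MeasurableSet.iInter fun i => MeasurableSet.iInter fun _ => hy.measurable i (hE i))
  have hYm : MeasurableSet (y k ⁻¹' E k) := hy.measurable k (hE k)
  -- On `H n j` the `k`-th point is the only point in the `j`-th cell of level `n`. For fixed `n`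
  -- these events are disjoint, and their union exhausts almost all of `Ω` as `n → ∞`.
  set H : ℕ → ℕ → Set Ω := fun n j => G ∩ ({ω | (N ω ∩ Ico 0 ((j : ℝ) / 2 ^ n) ×ˢ V).encard = k}
    ∩ {ω | (N ω ∩ cell n j ×ˢ V).encard = 1}) with hH
  have hHm : ∀ n j, MeasurableSet (H n j) := fun n j => hGm.inter
    ((hN.measurable_count _ (measurableSet_Ico.prod hV) (measurableSet_singleton (k : ℕ∞))).inter
      (hN.measurable_count _ ((measurableSet_cell n j).prod hV)
        (measurableSet_singleton (1 : ℕ∞))))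
  have hcap : ∀ n j : ℕ, Ici (0 : ℝ) ∩ Ico ((j : ℝ) / 2 ^ n) (((j : ℝ) + 1) / 2 ^ n) = cell n j :=
    fun n j => inter_eq_right.2 fun t ht => cell_nonneg (n := n) (j := j) ht
  have hHcell : ∀ n j, ∀ ω ∈ H n j, (p ω k).1 ∈ cell n j := by
    rintro n j ω ⟨h1, h2, h3⟩
    exact ((hp ω h1).1.isolated_iff (a := (j : ℝ) / 2 ^ n) (b := ((j : ℝ) + 1) / 2 ^ n)
      (k := k) univ (by rw [inter_strip_before]; exact h2)
      (by rw [inter_strip_Ico, hcap, inter_univ]; exact h3)).1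
  -- On `H n j` the event `R` is visible off the cell: the grid counts by `gridSigma_le_traceSigma`,
  -- and the marks with `i < k` because their points precede the cell.
  have htrace : ∀ n ≥ m, ∀ j, MeasurableSet[traceSigma (countSigma N (cell n j ×ˢ V)ᶜ)
      (H n j)] R := by
    intro n hn j
    refine MeasurableSet.inter ?_ (MeasurableSet.iInter fun i => MeasurableSet.iInter fun hi => ?_)
    · exact gridSigma_le_traceSigma hV (fun ω hω => hω.2.2) D (gridSigma_mono hn D hD)
    · refine measurableSet_traceSigma.2
        ⟨markEvent N V i (E i) (Iic ((j : ℝ) / 2 ^ n)), ?_, ?_⟩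
      · refine measurableSet_markEvent (fun a ha => ?_) (fun a ha b hb => ?_)
          (fun a ha b hb => ?_)
        · refine measurable_count_of_subset (measurableSet_Ico.prod hV) fun q hq hq' => ?_
          exact absurd (hq.1.2.trans_le ha.2) (not_lt.2 hq'.1.1)
        · refine measurable_count_of_subset
            ((measurableSet_Ici.inter measurableSet_Ico).prod hV) fun q hq hq' => ?_
          exact absurd (hq.1.2.2.trans_le hb.2) (not_lt.2 hq'.1.1)
        · refine measurable_count_of_subset
            ((measurableSet_Ici.inter measurableSet_Ico).prod (hV.inter (hE i)))
            fun q hq hq' => ?_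
          exact absurd (hq.1.2.2.trans_le hb.2) (not_lt.2 hq'.1.1)
      · ext ω
        simp only [mem_inter_iff, mem_preimage]
        refine and_congr_left fun hω => ?_
        have hpω := hp ω hω.1
        have hbef := hω.2.1
        rw [mem_ofPred_eq, ← inter_strip_before, hpω.1.encard_before_eq_iff] at hbef
        rw [mem_markEvent hpω.1 (Or.inr ⟨_, rfl, (hbef i).2 hi⟩), hpω.2]
  have hcelleq : ∀ n ≥ m, ∀ j,
      P (R ∩ H n j ∩ y k ⁻¹' E k) = κ[|V] (E k) * P (R ∩ H n j) := by
    intro n hn j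
    obtain ⟨R', hR', hRR'⟩ := measurableSet_traceSigma.1 (htrace n hn j)
    rw [← prob_mark_cell hN hV hV0 hVtop hG0 (fun ω hω => (hp ω hω).1) (hE k) hR' hRR']
    congr 1
    ext ω
    simp only [mem_inter_iff, mem_preimage, mem_ofPred_eq]
    refine and_congr_right fun hω => ?_
    rw [(hp ω hω.2.1).2]
  have hdisj : ∀ n, Pairwise fun i j => Disjoint (H n i) (H n j) := by
    intro n i j hij
    refine Set.disjoint_left.2 fun ω hi hj => hij ?_
    have h0 := cell_nonneg (hHcell n i ω hi)
    exact ((mem_cell_iff h0).1 (hHcell n i ω hi)).symm.trans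
      ((mem_cell_iff h0).1 (hHcell n j ω hj))
  have hsum : ∀ n ≥ m, P (R ∩ (⋃ j, H n j) ∩ y k ⁻¹' E k)
      = κ[|V] (E k) * P (R ∩ ⋃ j, H n j) := by
    intro n hn
    rw [inter_iUnion, iUnion_inter, measure_iUnion, measure_iUnion, ← ENNReal.tsum_mul_left]
    · exact tsum_congr fun j => hcelleq n hn j
    · exact fun i j hij => (hdisj n hij).mono inter_subset_right inter_subset_right
    · exact fun j => hRm.inter (hHm n j)
    · exact fun i j hij => (hdisj n hij).mono (inter_subset_left.trans inter_subset_right)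
        (inter_subset_left.trans inter_subset_right)
    · exact fun j => (hRm.inter (hHm n j)).inter hYm
  -- The `k`-th point has positive distance from its neighbours, so cells shorter than that distance
  -- isolate it.
  have hlim : ∀ᵐ ω ∂P, ∀ᶠ n in atTop, ω ∈ ⋃ j, H n j := by
    filter_upwards [mem_ae_iff.2 hG0] with ω hω
    obtain ⟨hpω, -⟩ := hp ω hω
    obtain ⟨a, -, b, -, hak, hkb, -, ha, hab⟩ :=
      hpω.exists_isolating dense_univ (lt_add_one (p ω k).1)
    rw [hpω.encard_before_eq_iff] at ha
    obtain ⟨M, hM⟩ := hpω.exists_index b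
    have hM' : ∀ i, (p ω i).1 < b ↔ i < k + 1 := by
      rw [hpω.encard_Ico ha hM] at hab
      have hset : {i | k ≤ i ∧ i < M ∧ (p ω i).2 ∈ univ} = ↑(Finset.Ico k M) := by
        ext i; simp
      rw [hset, encard_coe_eq_coe_finsetCard, Nat.card_Ico] at hab
      have h1 : M - k = 1 := by exact_mod_cast hab
      obtain rfl : M = k + 1 := by omega
      exact hM
    filter_upwards [exists_pow_two_inv_lt (lt_min (sub_pos.2 hak) (sub_pos.2 hkb))] with n hn
    obtain ⟨hn1, hn2⟩ := lt_min_iff.1 hn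
    have h0 : 0 ≤ (p ω k).1 := (hpω.mem k).2.1
    have hc := (mem_cell_iff (n := n) h0).2 rfl
    set j := ⌊(p ω k).1 * 2 ^ n⌋₊
    obtain ⟨hc1, hc2⟩ := hc
    have hw : ((j : ℝ) + 1) / 2 ^ n = j / 2 ^ n + 1 / 2 ^ n := add_div _ _ _
    have hbefore : ∀ i, (p ω i).1 < (j : ℝ) / 2 ^ n ↔ i < k := fun i =>
      ⟨fun hi => hpω.strictMono.lt_iff_lt.1 (hi.trans_le hc1), fun hi => by
        have := (ha i).2 hi
        linarith⟩
    have hafter : ∀ i, (p ω i).1 < ((j : ℝ) + 1) / 2 ^ n ↔ i < k + 1 := fun i =>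
      ⟨fun hi => (hM' i).1 (by linarith), fun hi =>
        (hpω.strictMono.monotone (Nat.lt_succ_iff.1 hi)).trans_lt hc2⟩
    refine mem_iUnion.2 ⟨j, hω, ?_, ?_⟩
    · rw [mem_ofPred_eq, ← inter_strip_before]
      exact hpω.encard_before hbefore
    · rw [mem_ofPred_eq, ← hcap, ← inter_univ V, ← inter_strip_Ico, hpω.encard_Ico hbefore hafter]
      have hset : {i | k ≤ i ∧ i < k + 1 ∧ (p ω i).2 ∈ univ} = {k} := by
        ext i
        simp only [mem_univ, and_true, mem_ofPred_eq, mem_singleton_iff]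
        omega
      rw [hset, encard_singleton]
  have hSm : ∀ n, MeasurableSet (⋃ j, H n j) := fun n => MeasurableSet.iUnion (hHm n)
  have t1 : Tendsto (fun n => P (R ∩ (⋃ j, H n j) ∩ y k ⁻¹' E k)) atTop
      (𝓝 (P (R ∩ y k ⁻¹' E k))) := by
    refine tendsto_measure_of_ae_tendsto_indicator_of_isFiniteMeasure atTop (hRm.inter hYm)
      (fun n => (hRm.inter (hSm n)).inter hYm) ?_
    filter_upwards [hlim] with ω hω
    filter_upwards [hω] with n hn
    simp only [mem_inter_iff, hn, and_true]
  have t2 : Tendsto (fun n => P (R ∩ ⋃ j, H n j)) atTop (𝓝 (P R)) := by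
    refine tendsto_measure_of_ae_tendsto_indicator_of_isFiniteMeasure atTop hRm
      (fun n => hRm.inter (hSm n)) ?_
    filter_upwards [hlim] with ω hω
    filter_upwards [hω] with n hn
    simp only [mem_inter_iff, hn, and_true]
  have : IsProbabilityMeasure κ[|V] := cond_isProbabilityMeasure_of_finite hV0 hVtop
  refine tendsto_nhds_unique t1 ((ENNReal.Tendsto.const_mul t2
    (Or.inr (measure_ne_top _ _))).congr' ?_)
  filter_upwards [eventually_ge_atTop m] with n hn
  exact (hsum n hn).symm

theorem prob_marks (hN : IsPoissonProcess N ((volume.restrict (Ici (0 : ℝ))).prod κ) P)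
    (hV : MeasurableSet V) (hV0 : κ V ≠ 0) (hVtop : κ V ≠ ∞) {y : ℕ → Ω → K}
    (hy : IsMarkSeq P N V y) {m : ℕ} {D : Set Ω} (hD : MeasurableSet[gridSigma N V m] D)
    {E : ℕ → Set K} (hE : ∀ i, MeasurableSet (E i)) (n : ℕ) :
    P (D ∩ ⋂ i < n, y i ⁻¹' E i) = P D * ∏ i ∈ Finset.range n, κ[|V] (E i) := by
  induction n with
  | zero => simp
  | succ n ih =>
    rw [Finset.prod_range_succ, ← mul_assoc, ← ih, mul_comm,
      ← prob_mark_step hN hV hV0 hVtop hy hD hE n, inter_assoc]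
    congr 2
    ext ω
    simp only [mem_iInter, mem_inter_iff]
    exact ⟨fun h => ⟨fun i hi => h i (by omega), h n (by omega)⟩, fun h i hi => by
      rcases Nat.lt_succ_iff_lt_or_eq.1 hi with h1 | rfl
      exacts [h.1 i h1, h.2]⟩

/-- The σ-algebra of all dyadic grid counts and of the points outside the region. -/
@[reducible] def outerSigma {Ω K : Type*} [MeasurableSpace K] (N : Ω → Set (ℝ × K))
    (V : Set K) : MeasurableSpace Ω :=
  ⨆ n, gridSigma N V n

/-- Conditionally on `D`, finite cylinders have the product probabilities of `prob_marks`, and these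
characterise the infinite product. An event `D` of probability zero cannot be normalised and is
treated separately. -/
theorem indep_restrict_marks
    (hN : IsPoissonProcess N ((volume.restrict (Ici (0 : ℝ))).prod κ) P)
    (hV : MeasurableSet V) (hV0 : κ V ≠ 0) (hVtop : κ V ≠ ∞) {y : ℕ → Ω → K}
    (hy : IsMarkSeq P N V y) [IsProbabilityMeasure κ[|V]] {m : ℕ} {D : Set Ω}
    (hD : MeasurableSet[gridSigma N V m] D) :
    (P.restrict D).map (fun ω k => y k ω) = P D • Measure.infinitePi fun _ : ℕ => κ[|V] := by
  have hDm : MeasurableSet D := gridSigma_le_of_isPoissonProcess hN hV m D hD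
  have hYm : Measurable fun ω k => y k ω := measurable_pi_iff.2 hy.measurable
  rcases eq_or_ne (P D) 0 with h0 | h0
  · rw [h0, zero_smul, Measure.restrict_eq_zero.2 h0, Measure.map_zero]
  have key : (P D)⁻¹ • (P.restrict D).map (fun ω k => y k ω)
      = Measure.infinitePi fun _ : ℕ => κ[|V] := by
    classical
    refine Measure.eq_infinitePi _ fun s t ht => ?_
    obtain ⟨n, hn⟩ : ∃ n, s ⊆ Finset.range n :=
      ⟨s.sup id + 1, fun i hi => Finset.mem_range.2 (Nat.lt_succ_of_le (Finset.le_sup (f :=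
          id) hi))⟩
    have h := prob_marks hN hV hV0 hVtop hy hD
      (E := fun i => if i ∈ s then t i else univ) (fun i => by
        split_ifs
        exacts [ht i, .univ]) n
    have hset : D ∩ ⋂ i < n, y i ⁻¹' (if i ∈ s then t i else univ)
        = (fun ω k => y k ω) ⁻¹' (s : Set ℕ).pi t ∩ D := by
      ext ω
      simp only [mem_inter_iff, mem_iInter, mem_preimage, Set.mem_pi, Finset.mem_coe,
        and_comm (a := ω ∈ D)]
      refine and_congr_left fun _ => ⟨fun h i hi => ?_, fun h i _ => ?_⟩
      · simpa [hi] using h i (Finset.mem_range.1 (hn hi))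
      · split_ifs with hi
        exacts [h i hi, trivial]
    have hprod : ∏ i ∈ Finset.range n, κ[|V] (if i ∈ s then t i else univ)
        = ∏ i ∈ s, κ[|V] (t i) := by
      rw [← Finset.prod_subset hn fun i _ hi => by simp [hi]]
      exact Finset.prod_congr rfl fun i hi => by simp [hi]
    rw [Measure.smul_apply, Measure.map_apply hYm (.pi s.countable_toSet fun i _ => ht i),
      Measure.restrict_apply (hYm (.pi s.countable_toSet fun i _ => ht i)), ← hset, h, hprod,
      smul_eq_mul, ← mul_assoc, ENNReal.inv_mul_cancel h0 (measure_ne_top _ _), one_mul]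
  rw [← key, smul_smul, ENNReal.mul_inv_cancel h0 (measure_ne_top _ _), one_smul]

/-- The marks are i.i.d. with the normalised intensity as their law. -/
theorem map_marks (hN : IsPoissonProcess N ((volume.restrict (Ici (0 : ℝ))).prod κ) P)
    (hV : MeasurableSet V) (hV0 : κ V ≠ 0) (hVtop : κ V ≠ ∞) {y : ℕ → Ω → K}
    (hy : IsMarkSeq P N V y) [IsProbabilityMeasure κ[|V]] :
    P.map (fun ω k => y k ω) = Measure.infinitePi fun _ : ℕ => κ[|V] := by
  have h := indep_restrict_marks hN hV hV0 hVtop hy (m := 0) (D := univ) MeasurableSet.univ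
  simpa using h

/-- The marks are independent of the grid counts and of the points outside the region. -/
theorem indep_marks (hN : IsPoissonProcess N ((volume.restrict (Ici (0 : ℝ))).prod κ) P)
    (hV : MeasurableSet V) (hV0 : κ V ≠ 0) (hVtop : κ V ≠ ∞) {y : ℕ → Ω → K}
    (hy : IsMarkSeq P N V y) :
    Indep (outerSigma N V) (MeasurableSpace.comap (fun ω k => y k ω) inferInstance) P := by
  have hYm : Measurable fun ω k => y k ω := measurable_pi_iff.2 hy.measurable
  have : IsProbabilityMeasure κ[|V] := cond_isProbabilityMeasure_of_finite hV0 hVtop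
  refine indep_iSup_of_directed_le (fun m => ?_)
    (fun m => gridSigma_le_of_isPoissonProcess hN hV m) hYm.comap_le gridSigma_mono.directed_le
  refine (Indep_iff _ _ _).2 ?_
  rintro D _ hD ⟨F, hF, rfl⟩
  have h1 := congrArg (fun μ => μ F) (indep_restrict_marks hN hV hV0 hVtop hy hD)
  have h2 := congrArg (fun μ => μ F) (map_marks hN hV hV0 hVtop hy)
  simp only [Measure.smul_apply, smul_eq_mul] at h1
  rw [Measure.map_apply hYm hF, Measure.restrict_apply (hYm hF), ← h2,
    Measure.map_apply hYm hF] at h1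
  rw [inter_comm, h1]

end Step

/-! ### Convergence of the backward iterations -/

namespace LipFun

theorem lipConst_sub_le (f g : LipFun) : (f - g).lipConst ≤ dist f g :=
  le_add_of_nonneg_left (abs_nonneg _)

theorem lipschitzWith_lipConst : LipschitzWith 1 lipConst := by
  refine LipschitzWith.of_le_add fun f g => ?_
  refine le_trans ?_ (add_le_add_right (lipConst_sub_le f g) _)
  refine lipConst_le _ fun x y => ?_
  have h1 := g.abs_sub_le x y
  have h2 := (f - g).abs_sub_le x y
  simp only [sub_apply] at h2
  have h3 := abs_add_le (g y - g x) (f y - g y - (f x - g x))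
  rw [show g y - g x + (f y - g y - (f x - g x)) = f y - f x by ring] at h3
  linarith

theorem measurable_lipConst : Measurable lipConst := lipschitzWith_lipConst.continuous.measurable

theorem continuous_eval (z : ℝ) : Continuous fun f : LipFun => f z := by
  refine (LipschitzWith.of_dist_le_mul (K := ⟨1 + |z|, by positivity⟩) fun f g => ?_).continuous
  have h1 := (f - g).abs_sub_le 0 z
  have h2 : dist f g = |(f - g) 0| + (f - g).lipConst := rfl
  have h3 := abs_add_le ((f - g) 0) ((f - g) z - (f - g) 0)
  rw [add_sub_cancel, zero_sub, abs_neg] at *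
  change |f z - g z| ≤ (1 + |z|) * dist f g
  rw [h2]
  have h4 := abs_nonneg z
  have h5 := (f - g).lipConst_nonneg
  have h6 := abs_nonneg ((f - g) 0)
  simp only [sub_apply] at *
  nlinarith

theorem continuous_apply (f : LipFun) : Continuous f.toFun := by
  obtain ⟨K, hK⟩ := f.lipschitz
  exact hK.continuous

/-- Evaluation is continuous in the point and measurable in the function, which gives joint
measurability. -/
theorem measurable_apply : Measurable fun p : ℝ × LipFun => p.2 p.1 :=
  measurable_uncurry_of_continuous_of_measurable (u := fun (z : ℝ) (f : LipFun) => f z)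
    (fun f => f.continuous_apply) fun z => (continuous_eval z).measurable

end LipFun

theorem measurable_backIter {Ω : Type*} {m : MeasurableSpace Ω} {f : Ω → ℕ → LipFun}
    (hf : ∀ k, Measurable fun ω => f ω k) (n : ℕ) {z : Ω → ℝ} (hz : Measurable z) :
    Measurable fun ω => backIter (f ω) n (z ω) := by
  induction n generalizing z with
  | zero => exact hz
  | succ n ih => exact ih (LipFun.measurable_apply.comp (hz.prodMk (hf n)))

theorem abs_backIter_sub_le (g : ℕ → LipFun) (n : ℕ) (w z : ℝ) :
    |backIter g n w - backIter g n z| ≤ (∏ k ∈ Finset.range n, (g k).lipConst) * |w - z| := by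
  induction n generalizing w z with
  | zero => simp [backIter]
  | succ n ih =>
    refine (ih (g n w) (g n z)).trans ?_
    rw [Finset.prod_range_succ, mul_assoc]
    refine mul_le_mul_of_nonneg_left ?_
      (Finset.prod_nonneg fun k _ => (g k).lipConst_nonneg)
    rw [abs_sub_comm w z]
    exact (g n).abs_sub_le z w

/-- Bernoulli's inequality. It ensures that `ENNReal.ofReal` in `logDefect` truncates nothing. -/
theorem rpow_sub_one_div_le {l p : ℝ} (hl : 0 ≤ l) (hp : 0 < p) (hp1 : p ≤ 1) :
    (l ^ p - 1) / p ≤ l - 1 := by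
  have h := rpow_one_add_le_one_add_mul_self (s := l - 1) (by linarith) hp.le hp1
  rw [add_sub_cancel] at h
  rw [div_le_iff₀ hp]
  linarith

theorem tendsto_rpow_sub_one_div {l : ℝ} (hl : 0 < l) :
    Tendsto (fun n : ℕ => (l ^ (1 / ((n : ℝ) + 1)) - 1) / (1 / ((n : ℝ) + 1))) atTop
      (𝓝 (Real.log l)) := by
  have h := (Real.hasStrictDerivAt_const_rpow hl 0).hasDerivAt.tendsto_slope_zero
  simp only [Real.rpow_zero, one_mul, zero_add] at h
  have h2 : Tendsto (fun n : ℕ => 1 / ((n : ℝ) + 1)) atTop (𝓝[≠] 0) :=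
    tendsto_nhdsWithin_iff.2 ⟨tendsto_one_div_add_atTop_nhds_zero_nat,
      Eventually.of_forall fun n => by simp; positivity⟩
  refine (h.comp h2).congr fun n => ?_
  simp only [Function.comp, smul_eq_mul]
  exact (div_eq_inv_mul _ _).symm

/-- The difference between the tangent at `1` and the `n`-th power approximation of `log`. -/
def logDefect (n : ℕ) (l : ℝ) : ℝ≥0∞ :=
  ENNReal.ofReal (l - 1 - (l ^ (1 / ((n : ℝ) + 1)) - 1) / (1 / ((n : ℝ) + 1)))

/-- The definition rearranged without subtraction, so that it can be integrated in `ℝ≥0∞`. -/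
theorem logDefect_add {l : ℝ} (hl : 0 ≤ l) (n : ℕ) :
    logDefect n l + 1 + (n + 1) * ENNReal.ofReal l ^ (1 / ((n : ℝ) + 1))
      = ENNReal.ofReal l + (n + 1) := by
  have hp : 0 < 1 / ((n : ℝ) + 1) := by positivity
  have h := rpow_sub_one_div_le hl hp
    (by rw [div_le_one (by positivity)]; linarith [n.cast_nonneg (α := ℝ)])
  have hc : ((n : ℝ≥0∞) + 1) = ENNReal.ofReal ((n : ℝ) + 1) := by
    rw [ENNReal.ofReal_add (by positivity) zero_le_one]; simp
  rw [logDefect, ENNReal.ofReal_rpow_of_nonneg hl hp.le, hc, ← ENNReal.ofReal_one,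
    ← ENNReal.ofReal_add (by linarith) zero_le_one,
    ← ENNReal.ofReal_mul (by positivity), ← ENNReal.ofReal_add (by linarith) (by positivity),
    ← ENNReal.ofReal_add hl (by positivity)]
  congr 1
  field_simp
  ring

/-- For `l > 0` the defects tend to `l - 1 - log l`. At `l = 0` the `n`-th defect equals `n` and the
limit is `∞`, matching `log 0 = -∞`. Positive and negative parts of the logarithm stand on opposite
sides, again to avoid subtraction. -/
theorem le_liminf_logDefect {l : ℝ} (hl : 0 ≤ l) :
    ENNReal.ofReal l + (-ENNReal.log (ENNReal.ofReal l)).toENNReal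
      ≤ liminf (fun n => logDefect n l) atTop
        + (1 + (ENNReal.log (ENNReal.ofReal l)).toENNReal) := by
  rcases hl.eq_or_lt with rfl | hl
  · have h : Tendsto (fun n => logDefect n 0) atTop (𝓝 ∞) := by
      have : ∀ n : ℕ, logDefect n 0 = n := by
        intro n
        rw [logDefect, Real.zero_rpow (by positivity)]
        rw [show (0 : ℝ) - 1 - (0 - 1) / (1 / ((n : ℝ) + 1)) = n by field_simp; ring]
        simp
      simp only [this]
      exact ENNReal.tendsto_nat_nhds_top
    rw [h.liminf_eq]
    simp
  · have h : Tendsto (fun n => logDefect n l) atTop (𝓝 (ENNReal.ofReal (l - 1 - Real.log l))) :=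
      ENNReal.tendsto_ofReal ((tendsto_rpow_sub_one_div hl).const_sub _)
    rw [h.liminf_eq, ENNReal.log_ofReal_of_pos hl, ← EReal.coe_neg, EReal.toENNReal_of_ne_top
      (EReal.coe_ne_top _), EReal.toENNReal_of_ne_top (EReal.coe_ne_top _), EReal.toReal_coe,
      EReal.toReal_coe]
    have hlog := Real.log_le_sub_one_of_pos hl
    rcases le_total (Real.log l) 0 with h0 | h0
    · rw [ENNReal.ofReal_of_nonpos h0, add_zero, ← ENNReal.ofReal_one,
        ← ENNReal.ofReal_add hl.le (by linarith), ← ENNReal.ofReal_add (by linarith) zero_le_one]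
      exact ENNReal.ofReal_le_ofReal (by linarith)
    · rw [ENNReal.ofReal_of_nonpos (by linarith : -Real.log l ≤ 0), add_zero,
        ← ENNReal.ofReal_one, ← ENNReal.ofReal_add zero_le_one h0,
        ← ENNReal.ofReal_add (by linarith) (by linarith)]
      exact ENNReal.ofReal_le_ofReal (by linarith)

theorem measurable_logDefect (n : ℕ) : Measurable (logDefect n) := by
  unfold logDefect
  fun_prop

/-- A contractive random function has a moment `E L_f ^ p < 1` of some order `p ∈ (0, 1]`. -/
theorem ContractiveInMean.exists_moment_lt_one {ν : Measure LipFun} [IsProbabilityMeasure ν]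
    {z₀ : ℝ} (hν : ContractiveInMean ν z₀) :
    ∃ p : ℝ, 0 < p ∧ p ≤ 1 ∧ ∫⁻ f, ENNReal.ofReal f.lipConst ^ p ∂ν < 1 := by
  -- If `E L ^ p ≥ 1` for all `p ∈ (0, 1]`, then `p = 1 / (n + 1)` bounds the mean defects by `E L -
  -- 1`. Fatou's lemma then gives `E (log L)⁻ ≤ E (log L)⁺ < ∞`, against `E log L < 0`.
  by_contra! hcon
  have hL : Measurable fun f : LipFun => ENNReal.ofReal f.lipConst :=
    LipFun.measurable_lipConst.ennreal_ofReal
  set ℓ := ∫⁻ f : LipFun, ENNReal.ofReal f.lipConst ∂ν with hℓ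
  have hℓtop : ℓ ≠ ∞ := (hν.integrable_lipConst.lintegral_lt_top).ne
  have hn : ∀ n : ℕ, ∫⁻ f : LipFun, logDefect n f.lipConst ∂ν + 1 ≤ ℓ := by
    intro n
    have hD : Measurable fun f : LipFun => logDefect n f.lipConst :=
      (measurable_logDefect n).comp LipFun.measurable_lipConst
    have h1 : ∫⁻ f : LipFun, (logDefect n f.lipConst + 1
          + (n + 1) * ENNReal.ofReal f.lipConst ^ (1 / ((n : ℝ) + 1))) ∂ν
        = ∫⁻ f : LipFun, (ENNReal.ofReal f.lipConst + (n + 1)) ∂ν :=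
      lintegral_congr fun f => logDefect_add f.lipConst_nonneg n
    rw [lintegral_add_left (hD.add_const _), lintegral_add_left hD, lintegral_add_left hL,
      lintegral_const_mul _ (hL.pow_const _), lintegral_const, lintegral_const, measure_univ,
      mul_one, mul_one] at h1
    have h2 := hcon (1 / ((n : ℝ) + 1)) (by positivity)
      (by rw [div_le_one (by positivity)]; linarith [n.cast_nonneg (α := ℝ)])
    have h3 : ((n : ℝ≥0∞) + 1) ≠ ∞ := by finiteness
    refine (ENNReal.add_le_add_iff_right h3).1 ?_
    rw [← h1]
    gcongr
    exact le_mul_of_one_le_right (by positivity) h2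
  have hfatou : ∫⁻ f : LipFun, liminf (fun n => logDefect n f.lipConst) atTop ∂ν + 1 ≤ ℓ := by
    have h1 := lintegral_liminf_le (μ := ν) (u := atTop)
      (f := fun (n : ℕ) (f : LipFun) => logDefect n f.lipConst)
      (fun n => (measurable_logDefect n).comp LipFun.measurable_lipConst)
    have h2 : liminf (fun n : ℕ => ∫⁻ f : LipFun, logDefect n f.lipConst ∂ν) atTop ≤ ℓ - 1 := by
      refine liminf_le_of_le (by isBoundedDefault) fun b hb => ?_
      obtain ⟨n, hbn⟩ := hb.exists
      exact hbn.trans (ENNReal.le_sub_of_add_le_right ENNReal.one_ne_top (hn n))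
    have h3 : 1 ≤ ℓ := le_trans le_add_self (hn 0)
    calc _ ≤ ℓ - 1 + 1 := by gcongr; exact h1.trans h2
      _ = ℓ := tsub_add_cancel_of_le h3
  set a := ∫⁻ f : LipFun, (ENNReal.log (ENNReal.ofReal f.lipConst)).toENNReal ∂ν with ha
  set b := ∫⁻ f : LipFun, (-ENNReal.log (ENNReal.ofReal f.lipConst)).toENNReal ∂ν with hb
  have hlim : Measurable fun f : LipFun => liminf (fun n => logDefect n f.lipConst) atTop :=
    Measurable.liminf fun n => (measurable_logDefect n).comp LipFun.measurable_lipConst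
  have hba : b ≤ a := by
    have h := lintegral_mono (μ := ν) fun f : LipFun => le_liminf_logDefect f.lipConst_nonneg
    rw [lintegral_add_left hL, lintegral_add_left hlim, lintegral_add_left measurable_const,
      lintegral_const, measure_univ, mul_one, ← add_assoc] at h
    exact (ENNReal.add_le_add_iff_left hℓtop).1 (h.trans (by gcongr))
  have hatop : a ≠ ∞ := by
    refine ne_top_of_le_ne_top hℓtop (lintegral_mono fun f => ?_)
    rcases f.lipConst_nonneg.eq_or_lt with h | h
    · simp [← h]
    · rw [ENNReal.log_ofReal_of_pos h, EReal.toENNReal_of_ne_top (EReal.coe_ne_top _),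
        EReal.toReal_coe]
      exact ENNReal.ofReal_le_ofReal (by linarith [Real.log_le_sub_one_of_pos h])
  refine absurd hν.mean_log_neg (not_lt.2 ?_)
  change 0 ≤ ((a : ℝ≥0∞) : EReal) - ((b : ℝ≥0∞) : EReal)
  rw [EReal.sub_nonneg (Or.inl (by simpa using hatop)) (Or.inl (by simp))]
  exact_mod_cast hba

/-- The summands are eventually below `1`, where `r ≤ r ^ p` since `p ≤ 1`; so the increments
themselves are summable. -/
theorem exists_tendsto_of_tsum_rpow_ne_top {b : ℕ → ℝ} {p : ℝ} (hp : 0 < p) (hp1 : p ≤ 1)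
    (h : ∑' n, ENNReal.ofReal |b (n + 1) - b n| ^ p ≠ ∞) : ∃ l, Tendsto b atTop (𝓝 l) := by
  refine cauchySeq_tendsto_of_complete (cauchySeq_of_summable_dist ?_)
  refine (ENNReal.summable_toReal h).of_norm_bounded_eventually_nat ?_
  have h0 := ENNReal.tendsto_atTop_zero_of_tsum_ne_top h
  filter_upwards [h0.eventually_lt_const zero_lt_one] with n hn
  have h1 : ENNReal.ofReal |b (n + 1) - b n| ≤ 1 := by
    by_contra! hlt
    exact absurd hn (not_lt.2 (ENNReal.one_le_rpow hlt.le hp))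
  have h2 : ENNReal.ofReal |b (n + 1) - b n| ≤ ENNReal.ofReal |b (n + 1) - b n| ^ p := by
    simpa using ENNReal.rpow_le_rpow_of_exponent_ge h1 hp1
  rw [Real.norm_of_nonneg dist_nonneg, dist_comm, Real.dist_eq]
  have h3 := ENNReal.toReal_mono (hn.trans ENNReal.one_lt_top).ne h2
  rwa [ENNReal.toReal_ofReal (abs_nonneg _)] at h3

/-- The backward iterations of i.i.d. contractive random functions converge almost surely. -/
theorem ContractiveInMean.ae_tendsto_backIter {ν : Measure LipFun} [IsProbabilityMeasure ν]
    {z₀ : ℝ} (hν : ContractiveInMean ν z₀) :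
    ∀ᵐ f ∂(Measure.infinitePi fun _ : ℕ => ν),
      ∃ l, Tendsto (fun n => backIter f n z₀) atTop (𝓝 l) := by
  obtain ⟨p, hp, hp1, hρ⟩ := hν.exists_moment_lt_one
  set ρ := ∫⁻ f : LipFun, ENNReal.ofReal f.lipConst ^ p ∂ν
  set δ := ∫⁻ f : LipFun, ENNReal.ofReal |f z₀ - z₀| ^ p ∂ν with hδ
  have hLm : Measurable fun f : LipFun => ENNReal.ofReal f.lipConst ^ p :=
    LipFun.measurable_lipConst.ennreal_ofReal.pow_const _
  have hdm : Measurable fun f : LipFun => ENNReal.ofReal |f z₀ - z₀| ^ p :=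
    (((LipFun.continuous_eval z₀).measurable.sub_const z₀).abs).ennreal_ofReal.pow_const _
  have hδtop : δ ≠ ∞ := by
    have h1 : ∀ f : LipFun, ENNReal.ofReal |f z₀ - z₀| ^ p ≤ 1 + ENNReal.ofReal |f z₀ - z₀| := by
      intro f
      rcases le_total (ENNReal.ofReal |f z₀ - z₀|) 1 with h | h
      · exact (ENNReal.rpow_le_one h hp.le).trans le_self_add
      · refine le_trans ?_ le_add_self
        simpa using ENNReal.rpow_le_rpow_of_exponent_le h hp1
    refine ne_top_of_le_ne_top ?_ (lintegral_mono h1)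
    rw [lintegral_add_left measurable_const, lintegral_const, measure_univ, mul_one]
    exact ENNReal.add_ne_top.2 ⟨ENNReal.one_ne_top, hν.integrable_displacement.lintegral_lt_top.ne⟩
  -- The `n`-th increment is at most `L_0 ⋯ L_{n-1} |f_n(z₀) - z₀|`. Its `p`-th power is the product
  -- of the independent factors `h n k (f k)`, `k ≤ n`, with mean `ρ ^ n * δ`.
  let h : ℕ → ℕ → LipFun → ℝ≥0∞ := fun n k f =>
    if k < n then ENNReal.ofReal f.lipConst ^ p else ENNReal.ofReal |f z₀ - z₀| ^ p
  have hm : ∀ n k, Measurable (h n k) := fun n k => by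
    by_cases hk : k < n
    · simpa only [h, hk, if_true] using hLm
    · simpa only [h, hk, if_false] using hdm
  have hmean : ∀ n, ∫⁻ f, ∏ k ∈ Finset.range (n + 1), h n k (f k)
      ∂(Measure.infinitePi fun _ : ℕ => ν) = ρ ^ n * δ := by
    intro n
    rw [lintegral_prod_eq_prod_lintegral_of_indepFun _ (fun k (f : ℕ → LipFun) => h n k (f k))
      (iIndepFun_infinitePi (P := fun _ : ℕ => ν) (X := fun k => h n k) fun k => hm n k)
      (fun k => (hm n k).comp (measurable_pi_apply k))]
    have hk : ∀ k, ∫⁻ f : ℕ → LipFun, h n k (f k) ∂(Measure.infinitePi fun _ : ℕ => ν)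
        = ∫⁻ f, h n k f ∂ν := fun k =>
      (measurePreserving_eval_infinitePi (fun _ : ℕ => ν) k).lintegral_comp (hm n k)
    simp only [hk, Finset.prod_range_succ]
    rw [Finset.prod_congr rfl (g := fun _ => ρ), Finset.prod_const, Finset.card_range]
    · simp [h, hδ]
    · intro k hk
      simp [h, Finset.mem_range.1 hk, ρ]
  have hsum : ∫⁻ f, ∑' n, ∏ k ∈ Finset.range (n + 1), h n k (f k)
      ∂(Measure.infinitePi fun _ : ℕ => ν) ≠ ∞ := by
    have hmp : ∀ n, Measurable fun f : ℕ → LipFun =>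
        ∏ k ∈ Finset.range (n + 1), h n k (f k) := fun n =>
      Finset.measurable_fun_prod _ fun k _ => (hm n k).comp (measurable_pi_apply k)
    rw [lintegral_tsum fun n => (hmp n).aemeasurable]
    simp only [hmean]
    rw [ENNReal.tsum_mul_right, ENNReal.tsum_geometric]
    exact ENNReal.mul_ne_top (ENNReal.inv_ne_top.2 (tsub_pos_of_lt hρ).ne') hδtop
  have hmt : Measurable fun f : ℕ → LipFun =>
      ∑' n, ∏ k ∈ Finset.range (n + 1), h n k (f k) :=
    Measurable.tsum fun n => Finset.measurable_fun_prod _ fun k _ =>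
      (hm n k).comp (measurable_pi_apply k)
  filter_upwards [ae_lt_top hmt hsum] with f hf
  refine exists_tendsto_of_tsum_rpow_ne_top hp hp1 (ne_top_of_le_ne_top hf.ne
    (ENNReal.tsum_le_tsum fun n => ?_))
  have hle := abs_backIter_sub_le f n (f n z₀) z₀
  have hprod : ∏ k ∈ Finset.range (n + 1), h n k (f k)
      = (ENNReal.ofReal ((∏ k ∈ Finset.range n, (f k).lipConst) * |f n z₀ - z₀|)) ^ p := by
    rw [Finset.prod_range_succ, ENNReal.ofReal_mul (Finset.prod_nonneg fun k _ =>
      (f k).lipConst_nonneg), ENNReal.mul_rpow_of_nonneg _ _ hp.le,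
      ENNReal.ofReal_prod_of_nonneg fun k _ => (f k).lipConst_nonneg,
      ← ENNReal.prod_rpow_of_nonneg hp.le]
    congr 1
    · exact Finset.prod_congr rfl fun k hk => by simp [h, Finset.mem_range.1 hk]
    · simp [h]
  rw [hprod]
  exact ENNReal.rpow_le_rpow (ENNReal.ofReal_le_ofReal hle) hp.le

/-! ### Independence and conditioning up to null sets -/

section Markov

variable {Ω : Type*} {mΩ : MeasurableSpace Ω} {P : Measure Ω}

theorem eventuallyMeasurableSpace_mono {m m' : MeasurableSpace Ω} {l : Filter Ω}
    [CountableInterFilter l] (h : m ≤ m') :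
    eventuallyMeasurableSpace m l ≤ eventuallyMeasurableSpace m' l :=
  fun _ ⟨t, ht, hst⟩ => ⟨t, h t ht, hst⟩

theorem indep_of_le_eventuallyMeasurableSpace {m₁ m₂ m₁' m₂' : MeasurableSpace Ω}
    (h : Indep m₁ m₂ P) (h₁ : m₁' ≤ eventuallyMeasurableSpace m₁ (ae P))
    (h₂ : m₂' ≤ eventuallyMeasurableSpace m₂ (ae P)) : Indep m₁' m₂' P := by
  refine (Indep_iff _ _ _).2 fun s t hs ht => ?_
  obtain ⟨s', hs', hss'⟩ := h₁ s hs
  obtain ⟨t', ht', htt'⟩ := h₂ t ht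
  rw [measure_congr (hss'.inter htt'), measure_congr hss', measure_congr htt']
  exact (Indep_iff _ _ _).1 h s' t' hs' ht'

theorem isPiSystem_image2_inter (m₁ m₂ : MeasurableSpace Ω) :
    IsPiSystem (image2 (· ∩ ·) {s | MeasurableSet[m₁] s} {s | MeasurableSet[m₂] s}) := by
  rintro _ ⟨s, hs, t, ht, rfl⟩ _ ⟨s', hs', t', ht', rfl⟩ -
  exact ⟨s ∩ s', MeasurableSet.inter hs hs', t ∩ t', MeasurableSet.inter ht ht',
    inter_inter_inter_comm _ _ _ _⟩

theorem sup_eq_generateFrom_image2_inter (m₁ m₂ : MeasurableSpace Ω) :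
    m₁ ⊔ m₂ = MeasurableSpace.generateFrom
      (image2 (· ∩ ·) {s | MeasurableSet[m₁] s} {s | MeasurableSet[m₂] s}) := by
  apply le_antisymm
  · refine sup_le (fun s hs => ?_) (fun s hs => ?_)
    · exact MeasurableSpace.measurableSet_generateFrom ⟨s, hs, univ, .univ, inter_univ s⟩
    · exact MeasurableSpace.measurableSet_generateFrom ⟨univ, .univ, s, hs, univ_inter s⟩
  · refine MeasurableSpace.generateFrom_le ?_
    rintro _ ⟨s, hs, t, ht, rfl⟩
    exact MeasurableSet.inter (le_sup_left (a := m₁) (b := m₂) s hs)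
      (le_sup_right (a := m₁) (b := m₂) t ht)

/-- On the π-system of sets `s ∩ c` generating `m ⊔ C`: `P(a ∩ s ∩ c) = P(c) P(a ∩ s) = P(c) P(a)
P(s) = P(a) P(s ∩ c)`. -/
theorem indep_sup_of_indep_sup {Ω : Type*} {m A C mΩ : MeasurableSpace Ω} {P : Measure Ω}
    [IsProbabilityMeasure P] (hm : m ≤ mΩ) (hA : A ≤ mΩ)
    (hC : C ≤ mΩ) (h : Indep C (m ⊔ A) P) (h' : Indep A m P) : Indep A (m ⊔ C) P := by
  refine IndepSets.indep hA (sup_le hm hC) (@MeasurableSpace.isPiSystem_measurableSet Ω A)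
    (isPiSystem_image2_inter m C) (@MeasurableSpace.generateFrom_measurableSet Ω A).symm
    (sup_eq_generateFrom_image2_inter m C) ((IndepSets_iff _ _ _).2 ?_)
  rintro a _ ha ⟨s, hs, c, hc, rfl⟩
  have hs' : MeasurableSet[m ⊔ A] s := le_sup_left (a := m) (b := A) s hs
  have ha' : MeasurableSet[m ⊔ A] a := le_sup_right (a := m) (b := A) a ha
  have h1 := (Indep_iff _ _ _).1 h c s hc hs'
  have h2 := (Indep_iff _ _ _).1 h c (a ∩ s) hc (MeasurableSet.inter ha' hs')
  have h3 := (Indep_iff _ _ _).1 h' a s ha hs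
  change P (a ∩ (s ∩ c)) = P a * P (s ∩ c)
  rw [← inter_assoc, inter_comm _ c, h2, h3, inter_comm s c, h1]
  ring

/-- Independence for integrals: `∫ f` over `D ∩ a` factorises for `a` independent of `f`, `D`. -/
theorem setIntegral_inter_of_indep {Ω : Type*} {m A mΩ : MeasurableSpace Ω} {P : Measure Ω}
    [IsProbabilityMeasure P] (hm : m ≤ mΩ) (hA : A ≤ mΩ)
    (h : Indep A m P) {f : Ω → ℝ} (hf : StronglyMeasurable[m] f) (hfi : Integrable f P)
    {D a : Set Ω} (hD : MeasurableSet[m] D) (ha : MeasurableSet[A] a) :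
    ∫ ω in D ∩ a, f ω ∂P = P.real a * ∫ ω in D, f ω ∂P := by
  have h1 := condExp_indep_eq hm hA (hf.indicator hD) h.symm
  have h2 := setIntegral_condExp hA (hfi.indicator (hm D hD)) ha
  rw [setIntegral_congr_ae (g := fun _ => ∫ ω, D.indicator f ω ∂P) (hA a ha)
    (h1.mono fun ω hω _ => hω), setIntegral_const, integral_indicator (hm D hD),
    setIntegral_indicator (hm D hD), inter_comm, smul_eq_mul] at h2
  exact h2.symm

/-- If `A` is independent of `m ∨ C`, then conditioning an event of `m ∨ C` on a σ-algebra between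
`m` and `m ∨ A` is the same as conditioning on `m`, everything up to null sets. -/
theorem condExp_eq_of_indep_sup {Ω : Type*} {m F A C mΩ : MeasurableSpace Ω} {P : Measure Ω}
    [IsProbabilityMeasure P] (hmF : m ≤ F) (hF : F ≤ mΩ)
    (hA : A ≤ mΩ) (hC : C ≤ mΩ) (hind : Indep A (m ⊔ C) P)
    (hFA : F ≤ eventuallyMeasurableSpace (m ⊔ A) (ae P)) {E : Set Ω} (hE : MeasurableSet E)
    (hEC : MeasurableSet[eventuallyMeasurableSpace (m ⊔ C) (ae P)] E) :
    P⟦E | F⟧ =ᵐ[P] P⟦E | m⟧ := by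
  have hm : m ≤ mΩ := hmF.trans hF
  have hmC : m ⊔ C ≤ mΩ := sup_le hm hC
  have hmA : m ⊔ A ≤ mΩ := sup_le hm hA
  obtain ⟨E', hE', hEE'⟩ := hEC
  set f : Ω → ℝ := E.indicator fun _ => 1 with hf
  set f' : Ω → ℝ := E'.indicator fun _ => 1 with hf'
  have hff' : f =ᵐ[P] f' := indicator_ae_eq_of_ae_eq_set hEE'
  have hfi : Integrable f P := (integrable_const 1).indicator hE
  have hf'i : Integrable f' P := hfi.congr hff'
  have hf'm : StronglyMeasurable[m ⊔ C] f' := stronglyMeasurable_const.indicator hE'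
  have hhm : StronglyMeasurable[m] (P[f|m]) := stronglyMeasurable_condExp
  have hmeq : ∀ D, MeasurableSet[m] D → ∫ ω in D, (P[f|m]) ω ∂P = ∫ ω in D, f' ω ∂P := by
    intro D hD
    rw [setIntegral_condExp hm hfi hD]
    exact setIntegral_congr_ae (hm D hD) (hff'.mono fun ω hω _ => hω)
  -- On a rectangle `s ∩ a` both integrands are `m ⊔ C`-measurable, so the factor `P(a)` splits off
  -- and the claim reduces to `s ∈ m`. The π-λ theorem extends this to `m ⊔ A`.
  have hsup : ∀ D, MeasurableSet[m ⊔ A] D →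
      ∫ ω in D, (P[f|m]) ω ∂P = ∫ ω in D, f' ω ∂P := by
    intro D hD
    induction D, hD using MeasurableSpace.induction_on_inter
      (sup_eq_generateFrom_image2_inter m A) (isPiSystem_image2_inter m A) with
    | empty => simp
    | basic D hD =>
      obtain ⟨s, hs, a, ha, rfl⟩ := hD
      have h1 := setIntegral_inter_of_indep hmC hA hind
        (hhm.mono (le_sup_left (a := m) (b := C))) integrable_condExp
        (le_sup_left (a := m) (b := C) s hs) ha
      have h2 := setIntegral_inter_of_indep hmC hA hind hf'm hf'i
        (le_sup_left (a := m) (b := C) s hs) ha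
      beta_reduce
      rw [h1, h2, hmeq s hs]
    | compl D hD ih =>
      have h1 := integral_add_compl (hmA D hD) (integrable_condExp (f := f) (m := m) (μ := P))
      have h2 := integral_add_compl (hmA D hD) hf'i
      have h3 := hmeq univ .univ
      rw [setIntegral_univ, setIntegral_univ] at h3
      linarith
    | iUnion D hdisj hD ih =>
      rw [integral_iUnion (fun i => hmA _ (hD i)) hdisj integrable_condExp.integrableOn,
        integral_iUnion (fun i => hmA _ (hD i)) hdisj hf'i.integrableOn]
      exact tsum_congr ih
  refine (ae_eq_condExp_of_forall_setIntegral_eq hF hfi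
    (fun _ _ _ => integrable_condExp.integrableOn) (fun D hD _ => ?_)
    (hhm.mono hmF).aestronglyMeasurable).symm
  obtain ⟨D', hD', hDD'⟩ := hFA D hD
  rw [setIntegral_congr_set hDD', setIntegral_congr_set hDD', hsup D' hD']
  exact (setIntegral_congr_ae (hmA D' hD') (hff'.mono fun ω hω _ => hω)).symm

end Markov

/-! ### Positions and functions of the marks -/

theorem comap_pi_eq_generateFrom {Ω γ : Type*} [MeasurableSpace γ] (Z : Ω → ℕ → γ) :
    MeasurableSpace.comap Z inferInstance = MeasurableSpace.generateFrom
      {s | ∃ t ∈ squareCylinders (fun _ : ℕ => {s : Set γ | MeasurableSet s}), Z ⁻¹' t = s} := by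
  rw [show (inferInstance : MeasurableSpace (ℕ → γ)) = MeasurableSpace.pi from rfl,
    generateFrom_squareCylinders.symm, MeasurableSpace.comap_generateFrom]
  rfl

/-- The coordinates of i.i.d. pairs with a product law are independent sequences. -/
theorem indep_fst_snd_of_map_eq {Ω α β : Type*} [MeasurableSpace Ω] [MeasurableSpace α]
    [MeasurableSpace β] {P : Measure Ω} [IsProbabilityMeasure P] {μ : Measure (α × β)}
    [IsProbabilityMeasure μ] {y : ℕ → Ω → α × β} (hy : ∀ k, Measurable (y k))
    (hmap : P.map (fun ω k => y k ω) = Measure.infinitePi fun _ : ℕ => μ)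
    (hμ : ∀ U F, MeasurableSet U → MeasurableSet F →
      μ (U ×ˢ F) = μ (U ×ˢ univ) * μ (univ ×ˢ F)) :
    Indep (MeasurableSpace.comap (fun ω k => (y k ω).1) inferInstance)
      (MeasurableSpace.comap (fun ω k => (y k ω).2) inferInstance) P := by
  classical
  have hYm : Measurable fun ω k => y k ω := measurable_pi_iff.2 hy
  have h1 : Measurable fun ω k => (y k ω).1 := measurable_pi_iff.2 fun k => (hy k).fst
  have h2 : Measurable fun ω k => (y k ω).2 := measurable_pi_iff.2 fun k => (hy k).snd
  refine IndepSets.indep h1.comap_le h2.comap_le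
    (IsPiSystem.comap (isPiSystem_squareCylinders
      (fun _ => MeasurableSpace.isPiSystem_measurableSet) (by simp)) _)
    (IsPiSystem.comap (isPiSystem_squareCylinders
      (fun _ => MeasurableSpace.isPiSystem_measurableSet) (by simp)) _)
    (comap_pi_eq_generateFrom _) (comap_pi_eq_generateFrom _) ((IndepSets_iff _ _ _).2 ?_)
  rintro _ _ ⟨_, ⟨s, t, ht, rfl⟩, rfl⟩ ⟨_, ⟨s', t', ht', rfl⟩, rfl⟩
  simp only [Set.mem_pi, mem_univ, mem_ofPred_eq, forall_const] at ht ht'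
  set U : ℕ → Set α := fun i => if i ∈ s then t i else univ with hU
  set F : ℕ → Set β := fun i => if i ∈ s' then t' i else univ with hF
  have hUm : ∀ i, MeasurableSet (U i) := fun i => by
    simp only [hU]; split_ifs; exacts [ht i, .univ]
  have hFm : ∀ i, MeasurableSet (F i) := fun i => by
    simp only [hF]; split_ifs; exacts [ht' i, .univ]
  -- Both cylinders and their intersection are boxes over the common index set `s ∪ s'`, with `univ`
  -- in the unused coordinates; the product formula for `μ` then applies factor by factor.
  have box : ∀ (U : ℕ → Set α) (F : ℕ → Set β), (∀ i, MeasurableSet (U i)) →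
      (∀ i, MeasurableSet (F i)) →
      P ((fun ω k => y k ω) ⁻¹' (↑(s ∪ s') : Set ℕ).pi fun i => U i ×ˢ F i)
        = ∏ i ∈ s ∪ s', μ (U i ×ˢ F i) := by
    intro U F hU hF
    rw [← Measure.map_apply hYm (.pi (Finset.countable_toSet _) fun i _ => (hU i).prod (hF i)),
      hmap, Measure.infinitePi_pi _ fun i _ => (hU i).prod (hF i)]
  have e1 : (fun ω k => (y k ω).1) ⁻¹' (s : Set ℕ).pi t
      = (fun ω k => y k ω) ⁻¹' (↑(s ∪ s') : Set ℕ).pi fun i => U i ×ˢ univ := by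
    ext ω
    simp only [mem_preimage, Set.mem_pi, Finset.mem_coe, Finset.mem_union, mem_prod, mem_univ,
      and_true, hU]
    refine ⟨fun h i _ => ?_, fun h i hi => by simpa [hi] using h i (Or.inl hi)⟩
    split_ifs with hi
    exacts [h i hi, trivial]
  have e2 : (fun ω k => (y k ω).2) ⁻¹' (s' : Set ℕ).pi t'
      = (fun ω k => y k ω) ⁻¹' (↑(s ∪ s') : Set ℕ).pi fun i => univ ×ˢ F i := by
    ext ω
    simp only [mem_preimage, Set.mem_pi, Finset.mem_coe, Finset.mem_union, mem_prod, mem_univ,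
      true_and, hF]
    refine ⟨fun h i _ => ?_, fun h i hi => by simpa [hi] using h i (Or.inr hi)⟩
    split_ifs with hi
    exacts [h i hi, trivial]
  have e3 : (fun ω k => (y k ω).1) ⁻¹' (s : Set ℕ).pi t
        ∩ (fun ω k => (y k ω).2) ⁻¹' (s' : Set ℕ).pi t'
      = (fun ω k => y k ω) ⁻¹' (↑(s ∪ s') : Set ℕ).pi fun i => U i ×ˢ F i := by
    rw [e1, e2, ← preimage_inter, ← Set.pi_inter_distrib]
    congr 2
    ext i
    simp
  rw [e3, e1, e2, box U F hUm hFm, box U (fun _ => univ) hUm (fun _ => .univ),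
    box (fun _ => univ) F (fun _ => .univ) hFm, ← Finset.prod_mul_distrib]
  exact Finset.prod_congr rfl fun i _ => hμ _ _ (hUm i) (hFm i)

theorem measurable_sieve {Ω : Type*} {m : MeasurableSpace Ω} {y : ℕ → Ω → ℝ × LipFun} (u : ℝ)
    (k : ℕ) (hX : Measurable fun ω => (y k ω).1) (hf : Measurable fun ω => (y k ω).2) :
    Measurable fun ω => sieve u (fun i => y i ω) k := by
  classical
  exact Measurable.ite (hX measurableSet_Icc) hf measurable_const

/-- The limsup is measurable whether or not the limit exists, and it agrees almost surely with the
limit. -/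
theorem measurable_of_ae_tendsto {Ω : Type*} {m mΩ : MeasurableSpace Ω} {P : Measure Ω}
    {Z : ℕ → Ω → ℝ} {ζ : Ω → ℝ}
    (hZ : ∀ n, Measurable[eventuallyMeasurableSpace m (ae P)] (Z n))
    (h : ∀ᵐ ω ∂P, Tendsto (fun n => Z n ω) atTop (𝓝 (ζ ω))) :
    Measurable[eventuallyMeasurableSpace m (ae P)] ζ := by
  have hl := Measurable.limsup hZ
  refine EventuallyMeasurable.congr hl ?_
  filter_upwards [h] with ω hω
  exact hω.limsup_eq.symm

/-- The σ-algebra generated by the positions of a sequence of marks. -/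
abbrev positionSigma {Ω : Type*} (y : ℕ → Ω → ℝ × LipFun) : MeasurableSpace Ω :=
  MeasurableSpace.comap (fun ω k => (y k ω).1) inferInstance

/-- The σ-algebra generated by the functions of a sequence of marks. -/
abbrev functionSigma {Ω : Type*} (y : ℕ → Ω → ℝ × LipFun) : MeasurableSpace Ω :=
  MeasurableSpace.comap (fun ω k => (y k ω).2) inferInstance

theorem genSigma_singleton {Ω : Type*} (ζ : ℝ → Ω → ℝ) (x : ℝ) :
    genSigma ζ {x} = MeasurableSpace.comap (ζ x) inferInstance := by
  simp [genSigma]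

/-- The intensity of the marks, `Leb ⊗ ν` on `ℝ₊ × 𝒢`. -/
def markIntensity (ν : Measure LipFun) : Measure (ℝ × LipFun) :=
  (volume.restrict (Ici (0 : ℝ))).prod ν

instance {ν : Measure LipFun} [IsProbabilityMeasure ν] : SFinite (markIntensity ν) :=
    by unfold markIntensity; infer_instance

theorem measurableSet_markRegion (x : ℝ) : MeasurableSet (markRegion x) :=
  measurableSet_Icc.prod .univ

/-! ### The limits in terms of the marks -/

section Limit

variable {ν : Measure LipFun} {Ω : Type*} [MeasurableSpace Ω] {P : Measure Ω}
  {N : Ω → Set (ℝ × ℝ × LipFun)} {z₀ x : ℝ} {y : ℕ → Ω → ℝ × LipFun} {ζ : ℝ → Ω → ℝ}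

theorem outerSigma_le (hN : IsPoissonProcess N (sieveIntensity ν) P) (x : ℝ) :
    outerSigma N (markRegion x) ≤ ‹MeasurableSpace Ω› :=
  iSup_le fun n => gridSigma_le_of_isPoissonProcess hN (measurableSet_markRegion x) n

/-- Almost surely, `ζ(u)` is the limit of the sieved backward iterations of the marks of the
points of the region of a given `x ≥ u`. -/
theorem ae_tendsto_sieve (hy : IsMarkSeq P N (markRegion x) y) (hζ : IsSievedLimit P N z₀ ζ)
    {u : ℝ} (hu : 0 < u) (hux : u ≤ x) :
    ∀ᵐ ω ∂P, Tendsto (fun n => backIter (sieve u fun i => y i ω) (n + 1) z₀) atTop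
      (𝓝 (ζ u ω)) := by
  filter_upwards [hy.ae_enumerates, hζ.tendsto u hu] with ω hω hlim
  obtain ⟨p, hp, hyp⟩ := hω
  refine (hlim.comp hp.tendsto).congr fun n => ?_
  simp only [Function.comp, hyp]
  exact sievedIter_time hux hp n z₀

theorem ae_tendsto_backIter (hy : IsMarkSeq P N (markRegion x) y) (hζ : IsSievedLimit P N z₀ ζ)
    (hx : 0 < x) :
    ∀ᵐ ω ∂P, Tendsto (fun n => backIter (fun i => (y i ω).2) n z₀) atTop (𝓝 (ζ x ω)) := by
  filter_upwards [ae_tendsto_sieve hy hζ hx le_rfl, hy.ae_enumerates] with ω hω hen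
  obtain ⟨p, hp, hyp⟩ := hen
  rw [sieve_eq_of_mem fun i => by rw [hyp]; exact (hp.mem i).2.2.1] at hω
  exact (tendsto_add_atTop_iff_nat 1).1 hω

theorem genSigma_le (hζ : IsSievedLimit P N z₀ ζ) {I : Set ℝ} (hI : ∀ u ∈ I, 0 < u) :
    genSigma ζ I ≤ ‹MeasurableSpace Ω› :=
  iSup₂_le fun u hu => (hζ.measurable u (hI u hu)).comap_le

end Limit

/-! ### The mark law of a strip, and recovery -/

section Region

variable {ν : Measure LipFun} [IsProbabilityMeasure ν]

theorem markIntensity_markRegion (x : ℝ) :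
    markIntensity ν (markRegion x) = ENNReal.ofReal x := by
  rw [markIntensity, markRegion, Measure.prod_prod, measure_univ, mul_one,
    Measure.restrict_apply measurableSet_Icc, inter_eq_left.2 Icc_subset_Ici_self,
    Real.volume_Icc, sub_zero]

theorem markIntensity_markRegion_ne_zero {x : ℝ} (hx : 0 < x) :
    markIntensity ν (markRegion x) ≠ 0 := by
  rw [markIntensity_markRegion]
  exact (ENNReal.ofReal_pos.2 hx).ne'

theorem markIntensity_markRegion_ne_top (x : ℝ) : markIntensity ν (markRegion x) ≠ ∞ := by
  rw [markIntensity_markRegion]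
  exact ENNReal.ofReal_ne_top

theorem isProbabilityMeasure_markLaw {x : ℝ} (hx : 0 < x) :
    IsProbabilityMeasure ((markIntensity ν)[|markRegion x]) :=
  cond_isProbabilityMeasure_of_finite (markIntensity_markRegion_ne_zero hx)
    (markIntensity_markRegion_ne_top x)

/-- The intensity is a product and the region restricts the position only, so conditioning leaves
the function with law `ν`, independent of the position. -/
theorem markLaw_prod (x : ℝ) (U : Set ℝ) (F : Set LipFun) :
    (markIntensity ν)[|markRegion x] (U ×ˢ F)
      = (markIntensity ν)[|markRegion x] (U ×ˢ univ) * ν F := by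
  rw [cond_apply (measurableSet_markRegion x), cond_apply (measurableSet_markRegion x),
    markRegion, prod_inter_prod, prod_inter_prod, univ_inter, univ_inter, markIntensity,
    Measure.prod_prod, Measure.prod_prod, Measure.prod_prod, measure_univ, mul_one, mul_one,
    mul_assoc]

theorem markLaw_univ_prod {x : ℝ} (hx : 0 < x) (F : Set LipFun) :
    (markIntensity ν)[|markRegion x] (univ ×ˢ F) = ν F := by
  have := isProbabilityMeasure_markLaw (ν := ν) hx
  rw [markLaw_prod, univ_prod_univ, measure_univ, one_mul]

variable {Ω : Type*} [MeasurableSpace Ω] {P : Measure Ω} [IsProbabilityMeasure P]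
  {N : Ω → Set (ℝ × ℝ × LipFun)} {z₀ x : ℝ} {y : ℕ → Ω → ℝ × LipFun} {ζ : ℝ → Ω → ℝ}

theorem exists_isMarkSeq_markRegion (hN : IsPoissonProcess N (sieveIntensity ν) P) (hx : 0 < x) :
    ∃ y, IsMarkSeq P N (markRegion x) y :=
  have : Nonempty (ℝ × LipFun) := ⟨(0, LipFun.ident)⟩
  IsPoissonProcess.exists_isMarkSeq (κ := markIntensity ν) hN (measurableSet_markRegion x)
    (markIntensity_markRegion_ne_zero hx) (markIntensity_markRegion_ne_top x)

theorem map_functions (hN : IsPoissonProcess N (sieveIntensity ν) P) (hx : 0 < x)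
    (hy : IsMarkSeq P N (markRegion x) y) :
    P.map (fun ω k => (y k ω).2) = Measure.infinitePi fun _ : ℕ => ν := by
  have := isProbabilityMeasure_markLaw (ν := ν) hx
  have h := map_marks (κ := markIntensity ν) hN (measurableSet_markRegion x)
    (markIntensity_markRegion_ne_zero hx) (markIntensity_markRegion_ne_top x) hy
  have hYm : Measurable fun ω k => y k ω := measurable_pi_iff.2 hy.measurable
  have hsnd : ((markIntensity ν)[|markRegion x]).map Prod.snd = ν := by
    ext F hF
    rw [Measure.map_apply measurable_snd hF, ← univ_prod, markLaw_univ_prod hx]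
  have h2 := Measure.infinitePi_map_pi (fun _ : ℕ => (markIntensity ν)[|markRegion x])
    (f := fun _ => Prod.snd) fun _ => measurable_snd
  simp only [hsnd] at h2
  rw [← h2, ← h, Measure.map_map (by fun_prop) hYm]
  rfl

theorem indep_positions_functions (hN : IsPoissonProcess N (sieveIntensity ν) P) (hx : 0 < x)
    (hy : IsMarkSeq P N (markRegion x) y) :
    Indep (positionSigma y)
      (functionSigma y) P := by
  have := isProbabilityMeasure_markLaw (ν := ν) hx
  refine indep_fst_snd_of_map_eq hy.measurable (map_marks (κ := markIntensity ν) hN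
    (measurableSet_markRegion x) (markIntensity_markRegion_ne_zero hx)
    (markIntensity_markRegion_ne_top x) hy) fun U F _ _ => ?_
  rw [markLaw_prod, markLaw_univ_prod hx]

theorem indep_outer_sup (hN : IsPoissonProcess N (sieveIntensity ν) P) (hx : 0 < x)
    (hy : IsMarkSeq P N (markRegion x) y) :
    Indep (outerSigma N (markRegion x))
      (functionSigma y
        ⊔ positionSigma y) P := by
  refine indep_of_indep_of_le_right (indep_marks (κ := markIntensity ν) hN
    (measurableSet_markRegion x) (markIntensity_markRegion_ne_zero hx)
    (markIntensity_markRegion_ne_top x) hy) (sup_le ?_ ?_)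
  · have h : Measurable fun (q : ℕ → ℝ × LipFun) k => (q k).2 := by fun_prop
    rintro _ ⟨F, hF, rfl⟩
    exact ⟨_, h hF, rfl⟩
  · have h : Measurable fun (q : ℕ → ℝ × LipFun) k => (q k).1 := by fun_prop
    rintro _ ⟨F, hF, rfl⟩
    exact ⟨_, h hF, rfl⟩

theorem ae_exists_tendsto_backIter (hν : ContractiveInMean ν z₀)
    (hN : IsPoissonProcess N (sieveIntensity ν) P) (hx : 0 < x)
    (hy : IsMarkSeq P N (markRegion x) y) :
    ∀ᵐ ω ∂P, ∃ l, Tendsto (fun n => backIter (fun i => (y i ω).2) n z₀) atTop (𝓝 l) := by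
  have hm : Measurable fun ω k => (y k ω).2 := measurable_pi_iff.2 fun k => (hy.measurable k).snd
  have h := hν.ae_tendsto_backIter
  rw [← map_functions hN hx hy] at h
  exact ae_of_ae_map hm.aemeasurable h

/-- The limits `ζ(x)` exist almost surely. -/
theorem exists_isSievedLimit (hν : ContractiveInMean ν z₀)
    (hN : IsPoissonProcess N (sieveIntensity ν) P) : ∃ ζ, IsSievedLimit P N z₀ ζ := by
  have h : ∀ x : ℝ, ∃ Z : Ω → ℝ, Measurable Z ∧ (0 < x →
      ∀ᵐ ω ∂P, Tendsto (fun t => sievedIter (N ω) z₀ t x) atTop (𝓝 (Z ω))) := by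
    intro x
    rcases le_or_gt x 0 with hx | hx
    · exact ⟨0, measurable_const, fun h => absurd h (not_lt.2 hx)⟩
    obtain ⟨y, hy⟩ := exists_isMarkSeq_markRegion hN hx
    refine ⟨fun ω => limsup (fun n => backIter (fun i => (y i ω).2) n z₀) atTop,
      Measurable.limsup fun n => measurable_backIter (fun k => (hy.measurable k).snd) n
        measurable_const, fun _ => ?_⟩
    filter_upwards [ae_exists_tendsto_backIter hν hN hx hy, hy.ae_enumerates] with ω hω hen
    obtain ⟨l, hl⟩ := hω
    obtain ⟨p, hp, hyp⟩ := hen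
    rw [hl.limsup_eq]
    simp only [hyp] at hl
    exact tendsto_sievedIter hp hl
  choose Z hZ hZlim using h
  exact ⟨Z, fun x _ => hZ x, hZlim⟩

theorem aemeasurable_limUnder_backIter (hν : ContractiveInMean ν z₀) :
    AEMeasurable (fun f : ℕ → LipFun => limUnder atTop fun n => backIter f n z₀)
      (Measure.infinitePi fun _ : ℕ => ν) := by
  refine ⟨fun f => limsup (fun n => backIter f n z₀) atTop, Measurable.limsup fun n =>
    measurable_backIter (fun k => measurable_pi_apply k) n measurable_const, ?_⟩
  filter_upwards [hν.ae_tendsto_backIter] with f hf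
  obtain ⟨l, hl⟩ := hf
  rw [hl.limUnder_eq, hl.limsup_eq]

/-- By the recovery property, `ζ(x)` determines the marks of the points of its region. -/
theorem ae_functions_eq (hν : ContractiveInMean ν z₀)
    (hN : IsPoissonProcess N (sieveIntensity ν) P) {S : Set LipFun} (hS : MeasurableSet S)
    (hνS : ν S = 1) {g : ℕ → ℝ → LipFun} (hg : HasRecovery ν z₀ S g)
    (hζ : IsSievedLimit P N z₀ ζ) (hx : 0 < x) (hy : IsMarkSeq P N (markRegion x) y) :
    ∀ᵐ ω ∂P, ∀ k, (y k ω).2 = g k (ζ x ω) := by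
  have hm : Measurable fun ω k => (y k ω).2 := measurable_pi_iff.2 fun k => (hy.measurable k).snd
  have h1 : ∀ᵐ f ∂(Measure.infinitePi fun _ : ℕ => ν), ∀ k, f k ∈ S := by
    refine ae_all_iff.2 fun k => ?_
    have : ∀ᵐ f ∂ν, f ∈ S := (mem_ae_iff_prob_eq_one hS).2 hνS
    rw [← Measure.infinitePi_map_eval (fun _ : ℕ => ν) k] at this
    exact ae_of_ae_map (measurable_pi_apply k).aemeasurable this
  -- Recovery speaks only of points of the support, which carries all the mass of `limitLaw ν z₀`.
  have h2 : ∀ᵐ f ∂(Measure.infinitePi fun _ : ℕ => ν),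
      (limUnder atTop fun n => backIter f n z₀) ∈ (limitLaw ν z₀).support :=
    ae_of_ae_map (aemeasurable_limUnder_backIter hν)
      (Measure.support_mem_ae (μ := limitLaw ν z₀))
  rw [← map_functions hN hx hy] at h1 h2
  filter_upwards [ae_of_ae_map hm.aemeasurable h1, ae_of_ae_map hm.aemeasurable h2,
    ae_tendsto_backIter hy hζ hx] with ω hω1 hω2 hω3
  rw [hω3.limUnder_eq] at hω2
  exact hg.unique _ hω2 _ hω1 hω3

end Region

/-! ### The two sides of `x` -/

section Sides

variable {ν : Measure LipFun} [IsProbabilityMeasure ν]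

/-- This is where recovery enters the Markov property: knowing `ζ(x)` amounts to knowing all
functions of the strip, up to null sets. -/
theorem measurable_functions {Ω : Type*} {m mΩ : MeasurableSpace Ω} {P : Measure Ω}
    {x : ℝ} {y : ℕ → Ω → ℝ × LipFun} {ζ : ℝ → Ω → ℝ} {g : ℕ → ℝ → LipFun}
    (hgm : ∀ k, Measurable (g k)) (h : ∀ᵐ ω ∂P, ∀ k, (y k ω).2 = g k (ζ x ω))
    (hm : genSigma ζ {x} ≤ m) (k : ℕ) :
    Measurable[eventuallyMeasurableSpace m (ae P)] fun ω => (y k ω).2 := by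
  have hζ : Measurable[m] (ζ x) :=
    measurable_iff_comap_le.2 ((genSigma_singleton ζ x).symm.le.trans hm)
  refine Measurable.eventuallyMeasurable_of_eventuallyEq ((hgm k).comp hζ) ?_
  filter_upwards [h] with ω hω using hω k

/-- The left side `ζ(u)`, `u ≤ x`, is determined by the functions and the positions of the points
of the region of `x`. -/
theorem measurable_left {Ω : Type*} {m mΩ : MeasurableSpace Ω} {P : Measure Ω}
    [IsProbabilityMeasure P] {N : Ω → Set (ℝ × ℝ × LipFun)} {z₀ x u : ℝ}
    {y : ℕ → Ω → ℝ × LipFun} {ζ : ℝ → Ω → ℝ} (hζ : IsSievedLimit P N z₀ ζ)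
    (hy : IsMarkSeq P N (markRegion x) y) (hu : 0 < u) (hux : u ≤ x)
    (hX : positionSigma y ≤ m)
    (hf : ∀ k, Measurable[eventuallyMeasurableSpace m (ae P)] fun ω => (y k ω).2) :
    Measurable[eventuallyMeasurableSpace m (ae P)] (ζ u) := by
  refine measurable_of_ae_tendsto (fun n => ?_) (ae_tendsto_sieve hy hζ hu hux)
  refine measurable_backIter (fun k => measurable_sieve u k ?_ (hf k)) (n + 1) measurable_const
  have h1 : Measurable[m] fun ω k => (y k ω).1 := measurable_iff_comap_le.2 hX
  exact Measurable.mono ((measurable_pi_apply k).comp h1) le_eventuallyMeasurableSpace le_rfl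

/-- The right side `ζ(u)`, `u ≥ x`, is determined by the functions of the points of the region of
`x`, the numbers of these points and the points outside. -/
theorem measurable_right {Ω : Type*} {m mΩ : MeasurableSpace Ω} {P : Measure Ω}
    [IsProbabilityMeasure P] {N : Ω → Set (ℝ × ℝ × LipFun)} {z₀ x u : ℝ}
    {y : ℕ → Ω → ℝ × LipFun} {ζ : ℝ → Ω → ℝ} (hN : IsPoissonProcess N (sieveIntensity ν) P)
    (hζ : IsSievedLimit P N z₀ ζ)
    (hy : IsMarkSeq P N (markRegion x) y) (hu : 0 < u) (hxu : x ≤ u)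
    (hC : outerSigma N (markRegion x) ≤ m)
    (hf : ∀ k, Measurable[eventuallyMeasurableSpace m (ae P)] fun ω => (y k ω).2) :
    Measurable[eventuallyMeasurableSpace m (ae P)] (ζ u) := by
  obtain ⟨w, hw⟩ := exists_isMarkSeq_markRegion (P := P) hN hu
  have hsub : markRegion x ⊆ markRegion u := prod_mono (Icc_subset_Icc_right hxu) le_rfl
  have hgrid : ∀ a ∈ dyadics, Measurable[eventuallyMeasurableSpace m (ae P)]
      fun ω => (N ω ∩ Ico 0 a ×ˢ markRegion x).encard := by
    rintro _ ⟨⟨n, j⟩, rfl⟩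
    exact Measurable.mono (measurable_grid_count n j)
      (((le_iSup (fun n => gridSigma N (markRegion x) n) n).trans hC).trans
        le_eventuallyMeasurableSpace) le_rfl
  have hout : ∀ (I : Set ℝ) (A : Set (ℝ × LipFun)), MeasurableSet I → MeasurableSet A →
      Disjoint A (markRegion x) → Measurable[eventuallyMeasurableSpace m (ae P)]
        fun ω => (N ω ∩ I ×ˢ A).encard := by
    intro I A hI hA hd
    have hIA : I ×ˢ A ⊆ (Ici 0 ×ˢ markRegion x)ᶜ := fun q hq hq' =>
      Set.disjoint_left.1 hd hq.2 hq'.2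
    exact Measurable.mono (measurable_count_of_subset (hI.prod hA) hIA)
      (((le_sup_right.trans (le_iSup (fun n => gridSigma N (markRegion x) n) 0)).trans hC).trans
        le_eventuallyMeasurableSpace) le_rfl
  have hsplit : ∀ (ω : Ω) (I : Set ℝ) (A : Set (ℝ × LipFun)),
      (N ω ∩ I ×ˢ (markRegion u ∩ A)).encard = (N ω ∩ I ×ˢ (markRegion x ∩ A)).encard
        + (N ω ∩ I ×ˢ ((markRegion u \ markRegion x) ∩ A)).encard := by
    intro ω I A
    rw [← encard_union_eq, ← inter_union_distrib_left, ← prod_union, ← union_inter_distrib_right,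
      union_sdiff_cancel hsub]
    exact Set.disjoint_left.2 fun q hq hq' => hq'.2.2.1.2 hq.2.2.1
  -- Only sets `univ ×ˢ F` are tested, so inside the strip of `x` functions and grid counts suffice
  -- and the positions never enter.
  have hcount : ∀ F : Set LipFun, MeasurableSet F → ∀ a ∈ dyadics, ∀ b ∈ dyadics,
      Measurable[eventuallyMeasurableSpace m (ae P)]
        fun ω => (N ω ∩ (Ici 0 ∩ Ico a b) ×ˢ (markRegion u ∩ univ ×ˢ F)).encard := by
    intro F hF a ha b hb
    simp only [hsplit]
    refine Measurable.add (hy.measurable_count (fun k => ?_) hgrid ha hb) (hout _ _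
      (measurableSet_Ici.inter measurableSet_Ico) (((measurableSet_markRegion u).diff
        (measurableSet_markRegion x)).inter (MeasurableSet.univ.prod hF)) ?_)
    · have := hf k hF
      convert this using 1
      ext ω
      simp
    · exact Set.disjoint_left.2 fun q hq hq' => hq.1.2 hq'
  have hfu : ∀ k, Measurable[eventuallyMeasurableSpace m (ae P)] fun ω => (w k ω).2 := by
    intro k F hF
    have h := hw.measurableSet_of_counts (m := m) (E := univ ×ˢ F) (fun a ha => ?_)
      (fun a ha b hb => ?_) (hcount F hF) k
    · convert h using 1
      ext ω
      simp
    · have hs := fun ω => hsplit ω (Ico 0 a) univ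
      simp only [inter_univ] at hs
      simp only [hs]
      exact Measurable.add (hgrid a ha) (hout _ _ measurableSet_Ico
        ((measurableSet_markRegion u).diff (measurableSet_markRegion x)) disjoint_sdiff_left)
    · simpa using hcount univ .univ a ha b hb
  exact measurable_of_ae_tendsto (fun n => measurable_backIter hfu n measurable_const)
    (ae_tendsto_backIter hw hζ hu)

/-- Around `x`, the process is governed by the positions of the points of the region of `x` (on the
left) and by the outer σ-algebra (on the right), each independent of `ζ(x)` and the other one. -/
theorem exists_sides {Ω : Type*} [MeasurableSpace Ω] {P : Measure Ω} [IsProbabilityMeasure P]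
    {z₀ : ℝ} (hν : ContractiveInMean ν z₀) {N : Ω → Set (ℝ × ℝ × LipFun)}
    (hN : IsPoissonProcess N (sieveIntensity ν) P) {S : Set LipFun} (hS : MeasurableSet S)
    (hνS : ν S = 1) {g : ℕ → ℝ → LipFun} (hg : HasRecovery ν z₀ S g) {ζ : ℝ → Ω → ℝ}
    (hζ : IsSievedLimit P N z₀ ζ) {x : ℝ} (hx : 0 < x) :
    ∃ y : ℕ → Ω → ℝ × LipFun, positionSigma y ≤ ‹MeasurableSpace Ω› ∧
      Indep (positionSigma y) (genSigma ζ {x} ⊔ outerSigma N (markRegion x)) P ∧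
      Indep (outerSigma N (markRegion x)) (genSigma ζ {x} ⊔ positionSigma y) P ∧
      (∀ u, 0 < u → u ≤ x → Measurable[eventuallyMeasurableSpace
        (genSigma ζ {x} ⊔ positionSigma y) (ae P)] (ζ u)) ∧
      ∀ u, x ≤ u → Measurable[eventuallyMeasurableSpace
        (genSigma ζ {x} ⊔ outerSigma N (markRegion x)) (ae P)] (ζ u) := by
  obtain ⟨y, hy⟩ := exists_isMarkSeq_markRegion hN hx
  have hXm : Measurable fun ω k => (y k ω).1 :=
    measurable_pi_iff.2 fun k => (hy.measurable k).fst
  have hfm : Measurable fun ω k => (y k ω).2 :=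
    measurable_pi_iff.2 fun k => (hy.measurable k).snd
  have hC := outerSigma_le hN x
  have hCM : Indep (outerSigma N (markRegion x)) (functionSigma y ⊔ positionSigma y) P :=
      indep_outer_sup hN hx hy
  have hAM : Indep (positionSigma y) (functionSigma y ⊔ outerSigma N (markRegion x)) P :=
      indep_sup_of_indep_sup hfm.comap_le hXm.comap_le hC hCM
    (indep_positions_functions hN hx hy)
  -- The converse of recovery: `ζ(x)` is a limit of functions of the `f_k`. It turns independence
  -- from the functions into independence from `ζ(x)`.
  have hmM : genSigma ζ {x} ≤ eventuallyMeasurableSpace (functionSigma y) (ae P) := by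
    rw [genSigma_singleton]
    refine measurable_iff_comap_le.1 (measurable_of_ae_tendsto
      (fun n => measurable_backIter (fun k => ?_) n measurable_const)
      (ae_tendsto_backIter hy hζ hx))
    have h1 : Measurable[functionSigma y] fun ω k => (y k ω).2 := comap_measurable _
    exact Measurable.mono ((measurable_pi_apply k).comp h1) le_eventuallyMeasurableSpace le_rfl
  have hsup : ∀ B : MeasurableSpace Ω,
      genSigma ζ {x} ⊔ B ≤ eventuallyMeasurableSpace (functionSigma y ⊔ B) (ae P) := fun B =>
    sup_le (hmM.trans (eventuallyMeasurableSpace_mono le_sup_left))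
      (le_sup_right.trans le_eventuallyMeasurableSpace)
  have hrec := ae_functions_eq hν hN hS hνS hg hζ hx hy
  exact ⟨y, hXm.comap_le,
    indep_of_le_eventuallyMeasurableSpace hAM le_eventuallyMeasurableSpace
      (hsup (outerSigma N (markRegion x))),
    indep_of_le_eventuallyMeasurableSpace hCM le_eventuallyMeasurableSpace (hsup (positionSigma y)),
    fun u hu hux => measurable_left hζ hy hu hux le_sup_right
      (measurable_functions hg.measurable hrec le_sup_left),
    fun u hxu => measurable_right hN hζ hy (hx.trans_le hxu) hxu le_sup_right
      (measurable_functions hg.measurable hrec le_sup_left)⟩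

end Sides

end

/-! ### The two Markov properties -/

theorem mainTheorem5 {Ω : Type*} [MeasurableSpace Ω] (P : Measure Ω) [IsProbabilityMeasure P]
    (ν : Measure LipFun) [IsProbabilityMeasure ν] (z₀ : ℝ) (hν : ContractiveInMean ν z₀)
    (N : Ω → Set (ℝ × ℝ × LipFun)) (hN : IsPoissonProcess N (sieveIntensity ν) P)
    (S : Set LipFun) (hS : MeasurableSet S) (hνS : ν S = 1)
    (g : ℕ → ℝ → LipFun) (hg : HasRecovery ν z₀ S g) :
    (∃ ζ : ℝ → Ω → ℝ, IsSievedLimit P N z₀ ζ) ∧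
    ∀ ζ : ℝ → Ω → ℝ, IsSievedLimit P N z₀ ζ → IsMarkovForward P ζ ∧ IsMarkovReverse P ζ := by
  refine ⟨exists_isSievedLimit hν hN, fun ζ hζ => ?_⟩
  constructor
  · intro x y hx hxy B hB
    obtain ⟨p, hA, h1, -, hl, hr⟩ := exists_sides hν hN hS hνS hg hζ hx
    have hC := outerSigma_le hN x
    -- The past lies in `σ(ζ(x)) ∨ positions` and the future event in `σ(ζ(x)) ∨ outer`, up to null
    -- sets.
    exact condExp_eq_of_indep_sup (biSup_mono fun u hu => by rw [hu]; exact ⟨hx, le_rfl⟩)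
      (genSigma_le hζ fun u hu => hu.1) hA hC h1
      (iSup₂_le fun u hu => measurable_iff_comap_le.1 (hl u hu.1 hu.2))
      (hζ.measurable y (hx.trans_le hxy) hB) (hr y hxy hB)
  · intro x y hy hyx B hB
    have hx := hy.trans_le hyx
    obtain ⟨p, hA, -, h2, hl, hr⟩ := exists_sides hν hN hS hνS hg hζ hx
    have hC := outerSigma_le hN x
    -- The same with the roles of the positions and the outer σ-algebra exchanged.
    exact condExp_eq_of_indep_sup (biSup_mono fun u hu => by rw [hu]; exact self_mem_Ici)
      (genSigma_le hζ fun u hu => hx.trans_le hu) hC hA h2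
      (iSup₂_le fun u hu => measurable_iff_comap_le.1 (hr u hu))
      (hζ.measurable y hy hB) (hl y hy hyx hB)
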